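/- For a commutative complex Banach algebra $B$ let $\Delta(B)$ be its character space, that is, the set of nonzero multiplicative linear functionals on $B$ with the weak$^*$ topology, and let $\hat b(\varphi)=\varphi(b)$. $B$ is semisimple if $\hat b=0$ implies $b=0$. A multiplier of $B$ is a bounded linear operator $T:B\to B$ with $T(ab)=a\,T(b)$ for all $a,b\in B$. A bounded continuous function $\sigma:\Delta(B)\to\mathbb C$ is - the transform of a multiplier $T$ if $\widehat{T(a)}=\sigma\,\hat a$ for all $a\in B$; - a BSE-function if there is a constant $\beta>0$ with $\left|\sum_{k=1}^n\alpha_k\sigma(\varphi_k)\right|\le\beta\left\|\sum_{k=1}^n\alpha_k\varphi_k\right\|_{B^*}$ for all $n$, $\alpha_1,\dots,\alpha_n\in\mathbb C$ and $\varphi_1,\dots,\varphi_n\in\Delta(B)$. $B$ is a BSE-algebra if the set of transforms of multipliers of $B$ equals the set of BSE-functions on $\Delta(B)$. **Theorem 3.5.** Let $A\ne\{0\}$ be a semisimple, commutative, separable, unital complex Banach algebra, let $G$ be a compact Hausdorff abelian group with normalized Haar measure $\lambda$, and let $1<p<\infty$. Let $L^p(G,A)$ be the space of ($\lambda$-a.e.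 classes of) measurable functions $f:G\to A$ with $\|f\|_{p}=\left(\int_G\|f(x)\|^p\,d\lambda(x)\right)^{1/p}<\infty$, which is a commutative Banach algebra under the convolution $(f*g)(x)=\int_G f(y)\,g(y^{-1}x)\,d\lambda(y)$. Then $L^p(G,A)$ is a BSE-algebra if and only if $A$ is a BSE-algebra and $G$ is finite. -/

import Mathlib

open MeasureTheory Filter Topology WeakDual
open scoped ENNReal Convolution BoundedContinuousFunction

namespace BSE

set_option linter.unusedSectionVars false
set_option linter.overlappingInstances false
/-! ### Convolution of vector-valued functions on a compact abelian group

The group is written additively and carries its normalized Haar measure `μ`.  For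
`f g : G → A` the convolution is Mathlib's
`(f ⋆[ContinuousLinearMap.mul ℂ A, μ] g) x = ∫ y, f y * g (x - y) ∂μ`.
The lemmas of this section show that it is defined almost everywhere, associative and
submultiplicative on `L^p`; no countability assumption on `G` is made. -/

section Convolution

variable {G : Type*} [AddCommGroup G] [TopologicalSpace G] [IsTopologicalAddGroup G]
  [CompactSpace G] [MeasurableSpace G] [BorelSpace G] (μ : Measure G)
  [μ.IsAddHaarMeasure] [IsProbabilityMeasure μ]

/-- Young's inequality for continuous real functions. -/
theorem real_conv_bound (u v : C(G, ℝ)) (p : ℝ≥0∞) [Fact (1 ≤ p)] : Continuous (fun x => ∫ y, u y * v (x - y) ∂μ) ∧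
    eLpNorm (fun x => ∫ y, u y * v (x - y) ∂μ) p μ ≤ eLpNorm u 1 μ * eLpNorm v p μ := by
  let Φ : G → C(G, ℝ) := fun y => u y • v.comp ⟨fun x => x - y, by fun_prop⟩
  have hΦ : Continuous Φ := by
    have : Continuous (ContinuousMap.curry
      (⟨fun q : G × G => u q.1 * v (q.2 - q.1), by fun_prop⟩ : C(G × G, ℝ))) :=
      ContinuousMap.continuous _
    exact this
  have hi : Integrable Φ μ := hΦ.integrable_of_hasCompactSupport (HasCompactSupport.of_compactSpace _)
  have hw : ∀ x, (∫ y, Φ y ∂μ) x = ∫ y, u y * v (x - y) ∂μ := fun x => by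
    rw [ContinuousMap.integral_apply hi]; rfl
  refine ⟨(∫ y, Φ y ∂μ).continuous.congr hw, ?_⟩
  have h1 : ‖ContinuousMap.toLp p μ ℝ (∫ y, Φ y ∂μ)‖
      ≤ (∫ y, ‖u y‖ ∂μ) * ‖ContinuousMap.toLp p μ ℝ v‖ := by
    rw [← ContinuousLinearMap.integral_comp_comm _ hi, ← integral_mul_const]
    refine (norm_integral_le_integral_norm _).trans (le_of_eq ?_)
    refine integral_congr_ae (Eventually.of_forall fun y => ?_)
    simp only [Φ, map_smul, norm_smul]
    congr 1
    rw [Lp.norm_def, Lp.norm_def]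
    congr 1
    rw [eLpNorm_congr_ae (ContinuousMap.coeFn_toLp μ _), eLpNorm_congr_ae (ContinuousMap.coeFn_toLp μ _)]
    exact eLpNorm_comp_measurePreserving (v.continuous.aestronglyMeasurable) (measurePreserving_sub_right μ y)
  rw [Lp.norm_def, Lp.norm_def, eLpNorm_congr_ae (ContinuousMap.coeFn_toLp μ _),
    eLpNorm_congr_ae (ContinuousMap.coeFn_toLp μ _)] at h1
  have hu : Integrable u μ := u.continuous.integrable_of_hasCompactSupport (HasCompactSupport.of_compactSpace _)
  have fin : ∀ w : C(G, ℝ), eLpNorm w p μ ≠ ∞ := fun w =>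
    (w.continuous.memLp_of_hasCompactSupport (HasCompactSupport.of_compactSpace _)).eLpNorm_ne_top
  have e1 : (∫ y, ‖u y‖ ∂μ) = (eLpNorm u 1 μ).toReal := by
    rw [eLpNorm_one_eq_lintegral_enorm, integral_norm_eq_lintegral_enorm hu.1]
  rw [e1, ← ENNReal.toReal_mul, ENNReal.toReal_le_toReal (fin _)
    (ENNReal.mul_ne_top (memLp_one_iff_integrable.2 hu).eLpNorm_ne_top (fin _))] at h1
  convert h1 using 2
  exact funext fun x => (hw x).symm

variable {A : Type*} [NonUnitalNormedCommRing A] [NormedSpace ℂ A] [IsScalarTower ℂ A A]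
  [SMulCommClass ℂ A A] [CompleteSpace A]
variable {μ}

theorem cont_aesm {F : G → A} (hF : Continuous F) : AEStronglyMeasurable F μ :=
  (hF.memLp_of_hasCompactSupport (p := 1) (HasCompactSupport.of_compactSpace _)).1

theorem exists_dominating {f : G → A} (hf : AEStronglyMeasurable f μ)
    (h : ℕ → C(G, A))
    (hs : ∑' n, eLpNorm (f -  ⇑(h n)) 1 μ ≠ ∞) :
    ∃ D : ℕ → C(G, ℝ), (∀ i y, 0 ≤ D i y) ∧ (∀ n y, ‖h n y‖ₑ ≤ ∑' i, ‖D i y‖ₑ) ∧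
      ∑' i, eLpNorm (D i) 1 μ ≠ ∞ ∧ ∀ᵐ y ∂μ, Tendsto (fun n => h n y) atTop (𝓝 (f y)) := by
  let D : ℕ → C(G, ℝ) := fun n => Nat.casesOn n ⟨fun y => ‖h 0 y‖, by fun_prop⟩
    (fun n => ⟨fun y => ‖h (n + 1) y - h n y‖, by fun_prop⟩)
  have m : ∀ n, AEStronglyMeasurable (h n) μ := fun n => cont_aesm (h n).continuous
  refine ⟨D, ?_, ?_, ?_, ?_⟩
  · rintro (_ | i) y <;> simp [D]
  · intro n y
    refine le_trans ?_ (ENNReal.sum_le_tsum (Finset.range (n + 1)))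
    induction n with
    | zero => simp [D]
    | succ n ih =>
      rw [Finset.sum_range_succ]
      have : h (n + 1) y = h n y + (h (n + 1) y - h n y) := by abel
      rw [this]
      refine (enorm_add_le _ _).trans (add_le_add ih ?_)
      simp [D]
  · rw [tsum_eq_zero_add' ENNReal.summable]
    refine ENNReal.add_ne_top.2 ⟨?_, ?_⟩
    · exact ((D 0).continuous.memLp_of_hasCompactSupport (HasCompactSupport.of_compactSpace _)).eLpNorm_ne_top
    · refine ne_top_of_le_ne_top (b := ∑' n, (eLpNorm (f - ⇑(h (n + 1))) 1 μ + eLpNorm (f -  ⇑(h n)) 1 μ)) ?_ ?_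
      · rw [ENNReal.tsum_add]
        refine ENNReal.add_ne_top.2 ⟨?_, hs⟩
        exact ne_top_of_le_ne_top hs (ENNReal.tsum_comp_le_tsum_of_injective (add_left_injective 1) _)
      · refine ENNReal.tsum_le_tsum fun n => ?_
        have e : eLpNorm (D (n + 1)) 1 μ = eLpNorm ((f - ⇑(h n)) - (f - ⇑(h (n + 1)))) 1 μ := by
          rw [← eLpNorm_norm ((f - ⇑(h n)) - (f - ⇑(h (n + 1))))]
          congr 1
          ext y
          simp [D]
        rw [e, add_comm (eLpNorm _ _ _)]
        exact eLpNorm_sub_le (hf.sub (m _)) (hf.sub (m _)) le_rfl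
  · have h2 : ∫⁻ y, ∑' n, ‖f y - h n y‖ₑ ∂μ ≠ ∞ := by
      have := lintegral_tsum (fun n => (hf.sub (m n)).enorm)
      simp only [Pi.sub_apply] at this
      rw [this]
      simpa [eLpNorm_one_eq_lintegral_enorm] using hs
    filter_upwards [ae_lt_top' (AEMeasurable.tsum fun n => (hf.sub (m n)).enorm) h2] with y hy
    rw [tendsto_iff_edist_tendsto_0]
    have := ENNReal.tendsto_atTop_zero_of_tsum_ne_top hy.ne
    simpa [edist_comm, edist_eq_enorm_sub] using this

variable [μ.Regular]

theorem convolution_key {f g : G → A} (hf : Integrable f μ) (hg : Integrable g μ)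
    (h k : ℕ → C(G, A))
    (hs : ∑' n, eLpNorm (f -  ⇑(h n)) 1 μ ≠ ∞) (ks : ∑' n, eLpNorm (g -  ⇑(k n)) 1 μ ≠ ∞) :
    ∀ᵐ x ∂μ, ConvolutionExistsAt f g x (ContinuousLinearMap.mul ℂ A) μ ∧
      Tendsto (fun n => (h n ⋆[ContinuousLinearMap.mul ℂ A, μ] k n) x) atTop
        (𝓝 ((f ⋆[ContinuousLinearMap.mul ℂ A, μ] g) x)) := by
  obtain ⟨D, D0, hD, DS, Dlim⟩ := exists_dominating hf.1 h hs
  obtain ⟨E, E0, hE, ES, Elim⟩ := exists_dominating hg.1 k ks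
  have cmeas : ∀ u v : C(G, ℝ), ∀ x, Measurable fun y => ‖u y‖ₑ * ‖v (x - y)‖ₑ := fun u v x => by
    have h1 : Continuous fun y => u y := u.continuous
    have h2 : Continuous fun y => v (x - y) := by fun_prop
    exact h1.measurable.enorm.mul h2.measurable.enorm
  have e1 : ∀ u v : C(G, ℝ), (∀ y, 0 ≤ u y) → (∀ y, 0 ≤ v y) → ∀ x,
      ∫⁻ y, ‖u y‖ₑ * ‖v (x - y)‖ₑ ∂μ = ‖∫ y, u y * v (x - y) ∂μ‖ₑ := by
    intro u v u0 v0 x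
    have hc : Continuous fun y => u y * v (x - y) := by fun_prop
    rw [← ofReal_norm, Real.norm_of_nonneg (integral_nonneg fun y => mul_nonneg (u0 y) (v0 _)),
      ofReal_integral_eq_lintegral_ofReal
        (hc.integrable_of_hasCompactSupport (HasCompactSupport.of_compactSpace _))
        (Eventually.of_forall fun y => mul_nonneg (u0 y) (v0 _))]
    refine lintegral_congr fun y => ?_
    rw [← enorm_mul, ← ofReal_norm, Real.norm_of_nonneg (mul_nonneg (u0 y) (v0 _))]
  have N : ∀ x, ∫⁻ y, (∑' i, ‖D i y‖ₑ) * (∑' j, ‖E j (x - y)‖ₑ) ∂μ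
      = ∑' i, ∑' j, ‖∫ y, D i y * E j (x - y) ∂μ‖ₑ := by
    intro x
    simp_rw [← ENNReal.tsum_mul_right, ← ENNReal.tsum_mul_left]
    rw [lintegral_tsum (fun i => (Measurable.tsum fun j => cmeas _ _ x).aemeasurable)]
    congr 1; ext i
    rw [lintegral_tsum (fun j => (cmeas _ _ x).aemeasurable)]
    congr 1; ext j
    exact e1 _ _ (D0 i) (E0 j) x
  have : Fact ((1 : ℝ≥0∞) ≤ 1) := ⟨le_rfl⟩
  have cm : ∀ i j, Measurable fun x => ‖∫ y, D i y * E j (x - y) ∂μ‖ₑ := fun i j =>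
    (real_conv_bound μ (D i) (E j) 1).1.measurable.enorm
  have Nfin : ∫⁻ x, ∑' i, ∑' j, ‖∫ y, D i y * E j (x - y) ∂μ‖ₑ ∂μ ≠ ∞ := by
    rw [lintegral_tsum (fun i => (Measurable.tsum fun j => cm i j).aemeasurable)]
    refine ne_top_of_le_ne_top (ENNReal.mul_ne_top DS ES) ?_
    rw [← ENNReal.tsum_mul_right]
    refine ENNReal.tsum_le_tsum fun i => ?_
    rw [lintegral_tsum (fun j => (cm i j).aemeasurable), ← ENNReal.tsum_mul_left]
    refine ENNReal.tsum_le_tsum fun j => ?_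
    have := (real_conv_bound μ (D i) (E j) 1).2
    rwa [eLpNorm_one_eq_lintegral_enorm] at this
  filter_upwards [ae_lt_top' (AEMeasurable.tsum fun i =>
    (Measurable.tsum fun j => cm i j).aemeasurable) Nfin] with x hx
  rw [← N] at hx
  have bm : Measurable fun y => (∑' i, ‖D i y‖ₑ) * (∑' j, ‖E j (x - y)‖ₑ) :=
    (Measurable.tsum fun i => (D i).continuous.measurable.enorm).mul
      (Measurable.tsum fun j => (show Continuous fun y => E j (x - y) by fun_prop).measurable.enorm)
  have bfin := ae_lt_top bm hx.ne
  have hmn : ∀ n, Continuous fun y => h n y * k n (x - y) := fun n => by fun_prop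
  have hlim : ∀ᵐ y ∂μ, Tendsto (fun n => h n y * k n (x - y)) atTop (𝓝 (f y * g (x - y))) := by
    filter_upwards [Dlim, (Measure.measurePreserving_sub_left μ x).quasiMeasurePreserving.ae Elim] with y h1 h2
    exact h1.mul h2
  have hms : ∀ n, AEStronglyMeasurable (fun y => h n y * k n (x - y)) μ := fun n =>
    cont_aesm (hmn n)
  have hbd : ∀ n, ∀ᵐ y ∂μ, ‖h n y * k n (x - y)‖
      ≤ ((∑' i, ‖D i y‖ₑ) * (∑' j, ‖E j (x - y)‖ₑ)).toReal := by
    intro n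
    filter_upwards [bfin] with y hy
    rw [← toReal_enorm]
    refine ENNReal.toReal_mono hy.ne ?_
    calc ‖h n y * k n (x - y)‖ₑ ≤ ‖h n y‖ₑ * ‖k n (x - y)‖ₑ := by
          simp only [enorm_eq_nnnorm]; exact_mod_cast nnnorm_mul_le _ _
      _ ≤ _ := mul_le_mul' (hD n y) (hE n _)
  have bint := integrable_toReal_of_lintegral_ne_top bm.aemeasurable hx.ne
  refine ⟨?_, tendsto_integral_of_dominated_convergence _ hms bint hbd hlim⟩
  refine bint.mono' (aestronglyMeasurable_of_tendsto_ae atTop hms hlim) ?_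
  filter_upwards [ae_all_iff.2 hbd, hlim] with y hy1 hy2
  exact le_of_tendsto hy2.norm (Eventually.of_forall hy1)

theorem exists_approx {f : G → A} {q : ℝ≥0∞} (hq : 1 ≤ q) (hq' : q ≠ ∞) (hf : MemLp f q μ) :
    ∃ h : ℕ → C(G, A), ∑' n, eLpNorm (f -  ⇑(h n)) 1 μ ≠ ∞ ∧
      Tendsto (fun n => eLpNorm (f -  ⇑(h n)) q μ) atTop (𝓝 0) := by
  have : ∀ n : ℕ, ∃ g : C(G, A), eLpNorm (f - ⇑g) q μ ≤ (2⁻¹ : ℝ≥0∞) ^ n := fun n => by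
    obtain ⟨g, -, h2, h3, -⟩ := hf.exists_hasCompactSupport_eLpNorm_sub_le hq'
      (ε := (2⁻¹ : ℝ≥0∞) ^ n) (by simp)
    exact ⟨⟨g, h3⟩, h2⟩
  choose h hh using this
  refine ⟨h, ?_, ?_⟩
  · refine ne_top_of_le_ne_top (b := ∑' n : ℕ, (2⁻¹ : ℝ≥0∞) ^ n) (by simp) (ENNReal.tsum_le_tsum fun n => ?_)
    refine (eLpNorm_le_eLpNorm_of_exponent_le hq (hf.1.sub ?_)).trans (hh n)
    exact cont_aesm (h n).continuous
  · exact tendsto_of_tendsto_of_tendsto_of_le_of_le tendsto_const_nhds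
      (ENNReal.tendsto_pow_atTop_nhds_zero_of_lt_one (by simp)) (fun _ => zero_le) hh

theorem convolution_congr_ae {f f' g g' : G → A} (hf : f =ᵐ[μ] f') (hg : g =ᵐ[μ] g') :
    f ⋆[ContinuousLinearMap.mul ℂ A, μ] g = f' ⋆[ContinuousLinearMap.mul ℂ A, μ] g' := by
  ext x
  refine integral_congr_ae ?_
  filter_upwards [hf, (Measure.measurePreserving_sub_left μ x).quasiMeasurePreserving.ae_eq_comp hg]
    with y h1 h2
  simp only [Function.comp_apply] at h2
  simp [h1, h2]

theorem continuous_conv (h k : C(G, A)) :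
    Continuous (h ⋆[ContinuousLinearMap.mul ℂ A, μ] k) :=
  (HasCompactSupport.of_compactSpace k).continuous_convolution_right _
    ((h.continuous.integrable_of_hasCompactSupport
      (HasCompactSupport.of_compactSpace _)).locallyIntegrable) k.continuous

theorem eLpNorm_conv_continuous_le {p : ℝ≥0∞} (hp : 1 ≤ p) (h k : C(G, A)) :
    eLpNorm (h ⋆[ContinuousLinearMap.mul ℂ A, μ] k) p μ ≤ eLpNorm h p μ * eLpNorm k p μ := by
  have : Fact (1 ≤ p) := ⟨hp⟩
  have key := (real_conv_bound μ ⟨fun y => ‖h y‖, by fun_prop⟩ ⟨fun y => ‖k y‖, by fun_prop⟩ p).2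
  simp only [ContinuousMap.coe_mk] at key
  rw [eLpNorm_norm, eLpNorm_norm] at key
  refine le_trans (eLpNorm_mono_real fun x => ?_) (key.trans ?_)
  · refine (norm_integral_le_of_norm_le ?_ (Eventually.of_forall fun y => ?_))
    · have hc : Continuous fun y => ‖h y‖ * ‖k (x - y)‖ := by fun_prop
      exact hc.integrable_of_hasCompactSupport (HasCompactSupport.of_compactSpace _)
    · exact norm_mul_le _ _
  · gcongr
    exact eLpNorm_le_eLpNorm_of_exponent_le hp (cont_aesm h.continuous)

/-- The integral that defines the convolution converges at almost every point. -/
theorem ae_convolutionExistsAt {f g : G → A} (hf : Integrable f μ) (hg : Integrable g μ) :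
    ∀ᵐ x ∂μ, ConvolutionExistsAt f g x (ContinuousLinearMap.mul ℂ A) μ := by
  obtain ⟨h, hs, -⟩ := exists_approx le_rfl ENNReal.one_ne_top (memLp_one_iff_integrable.2 hf)
  obtain ⟨k, ks, -⟩ := exists_approx le_rfl ENNReal.one_ne_top (memLp_one_iff_integrable.2 hg)
  exact (convolution_key hf hg h k hs ks).mono fun x hx => hx.1

/-- The convolution of two `L^p` functions is a.e. strongly measurable, and
`‖f ⋆ g‖_p ≤ ‖f‖_p ‖g‖_p`. -/
theorem eLpNorm_conv_le {p : ℝ≥0∞} (hp : 1 ≤ p) {f g : G → A} (hf : MemLp f p μ)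
    (hg : MemLp g p μ) : AEStronglyMeasurable (f ⋆[ContinuousLinearMap.mul ℂ A, μ] g) μ ∧
    eLpNorm (f ⋆[ContinuousLinearMap.mul ℂ A, μ] g) p μ ≤ eLpNorm f p μ * eLpNorm g p μ := by
  have hf1 := hf.integrable hp
  have hg1 := hg.integrable hp
  constructor
  · obtain ⟨h, hs, -⟩ := exists_approx le_rfl ENNReal.one_ne_top (memLp_one_iff_integrable.2 hf1)
    obtain ⟨k, ks, -⟩ := exists_approx le_rfl ENNReal.one_ne_top (memLp_one_iff_integrable.2 hg1)
    exact aestronglyMeasurable_of_tendsto_ae atTop (fun n => cont_aesm (continuous_conv (h n) (k n)))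
      ((convolution_key hf1 hg1 h k hs ks).mono fun x hx => hx.2)
  rcases eq_or_ne p ∞ with rfl | hp'
  · rw [eLpNorm_exponent_top]
    refine essSup_le_of_ae_le _ (Eventually.of_forall fun x => ?_)
    refine (enorm_integral_le_lintegral_enorm _).trans ?_
    have : ∀ᵐ y ∂μ, ‖ContinuousLinearMap.mul ℂ A (f y) (g (x - y))‖ₑ
        ≤ eLpNorm f ∞ μ * eLpNorm g ∞ μ := by
      filter_upwards [enorm_ae_le_eLpNormEssSup f μ,
        (Measure.measurePreserving_sub_left μ x).quasiMeasurePreserving.ae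
          (enorm_ae_le_eLpNormEssSup g μ)] with y h1 h2
      refine le_trans ?_ (mul_le_mul' h1 h2)
      simp only [enorm_eq_nnnorm]; exact_mod_cast nnnorm_mul_le _ _
    refine (lintegral_mono_ae this).trans ?_
    simp
  · obtain ⟨h, hs, ht⟩ := exists_approx hp hp' hf
    obtain ⟨k, ks, kt⟩ := exists_approx hp hp' hg
    have nt : ∀ (f : G → A) (h : ℕ → C(G, A)), MemLp f p μ →
        Tendsto (fun n => eLpNorm (f - ⇑(h n)) p μ) atTop (𝓝 0) →
        Tendsto (fun n => eLpNorm f p μ + eLpNorm (f - ⇑(h n)) p μ) atTop (𝓝 (eLpNorm f p μ)) := by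
      intro f h _ ht
      simpa using (tendsto_const_nhds (x := eLpNorm f p μ)).add ht
    have le : ∀ (f : G → A) (h : C(G, A)), MemLp f p μ →
        eLpNorm h p μ ≤ eLpNorm f p μ + eLpNorm (f - ⇑h) p μ := by
      intro f h hf
      have := eLpNorm_sub_le hf.1 (hf.1.sub (cont_aesm h.continuous)) hp
      simpa using this
    refine (Lp.eLpNorm_lim_le_liminf_eLpNorm
      (fun n => cont_aesm (continuous_conv (h n) (k n))) _
      ((convolution_key hf1 hg1 h k hs ks).mono fun x hx => hx.2)).trans ?_
    refine (liminf_le_liminf (Eventually.of_forall fun n =>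
      (eLpNorm_conv_continuous_le hp (h n) (k n)).trans
        (mul_le_mul' (le f (h n) hf) (le g (k n) hg)))).trans (le_of_eq ?_)
    exact (ENNReal.Tendsto.mul (nt f h hf ht) (Or.inr hg.eLpNorm_ne_top) (nt g k hg kt)
      (Or.inr hf.eLpNorm_ne_top)).liminf_eq

theorem memLp_conv {p : ℝ≥0∞} (hp : 1 ≤ p) {f g : G → A} (hf : MemLp f p μ)
    (hg : MemLp g p μ) : MemLp (f ⋆[ContinuousLinearMap.mul ℂ A, μ] g) p μ :=
  ⟨(eLpNorm_conv_le hp hf hg).1, (eLpNorm_conv_le hp hf hg).2.trans_lt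
    (ENNReal.mul_lt_top hf.eLpNorm_lt_top hg.eLpNorm_lt_top)⟩

theorem conv_comm (f g : G → A) :
    f ⋆[ContinuousLinearMap.mul ℂ A, μ] g = g ⋆[ContinuousLinearMap.mul ℂ A, μ] f := by
  rw [← convolution_flip]
  congr 1
  ext a b
  simp

theorem conv_assoc_continuous (f g h : C(G, A)) :
    (f ⋆[ContinuousLinearMap.mul ℂ A, μ] g) ⋆[ContinuousLinearMap.mul ℂ A, μ] h =
      f ⋆[ContinuousLinearMap.mul ℂ A, μ] (g ⋆[ContinuousLinearMap.mul ℂ A, μ] h) := by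
  ext x
  have i1 : ∀ F : G → A, Continuous F → Integrable F μ := fun F hF =>
    hF.integrable_of_hasCompactSupport (HasCompactSupport.of_compactSpace _)
  have mr : ∀ F : G → A, Continuous F → ∀ a : A, (∫ y, F y ∂μ) * a = ∫ y, F y * a ∂μ :=
    fun F hF a => (((ContinuousLinearMap.mul ℂ A).flip a).integral_comp_comm (i1 F hF)).symm
  have ml : ∀ F : G → A, Continuous F → ∀ a : A, a * (∫ y, F y ∂μ) = ∫ y, a * F y ∂μ :=
    fun F hF a => (((ContinuousLinearMap.mul ℂ A) a).integral_comp_comm (i1 F hF)).symm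
  calc ∫ z, (∫ y, f y * g (z - y) ∂μ) * h (x - z) ∂μ
      = ∫ z, ∫ y, f y * g (z - y) * h (x - z) ∂μ ∂μ := by
        congr 1; ext z; exact mr _ (by fun_prop) _
    _ = ∫ y, ∫ z, f y * g (z - y) * h (x - z) ∂μ ∂μ :=
        integral_integral_swap_of_hasCompactSupport (f := fun z y => f y * g (z - y) * h (x - z))
          (by fun_prop) (HasCompactSupport.of_compactSpace _)
    _ = ∫ y, f y * ∫ w, g w * h (x - y - w) ∂μ ∂μ := by
        congr 1; ext y
        rw [ml _ (by fun_prop),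
          ← integral_sub_right_eq_self (fun w => f y * (g w * h (x - y - w))) y]
        congr 1; ext z
        rw [mul_assoc, sub_sub, add_sub_cancel]

theorem conv_assoc_ae {f g h : G → A} (hf : Integrable f μ) (hg : Integrable g μ)
    (hh : Integrable h μ) :
    (f ⋆[ContinuousLinearMap.mul ℂ A, μ] g) ⋆[ContinuousLinearMap.mul ℂ A, μ] h =ᵐ[μ]
      f ⋆[ContinuousLinearMap.mul ℂ A, μ] (g ⋆[ContinuousLinearMap.mul ℂ A, μ] h) := by
  let B₀ : Lp A 1 μ → Lp A 1 μ → Lp A 1 μ := fun f g =>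
    (memLp_conv le_rfl (Lp.memLp f) (Lp.memLp g)).toLp _
  have B₀_coe : ∀ f g, (B₀ f g : G → A) =ᵐ[μ] f ⋆[ContinuousLinearMap.mul ℂ A, μ] g :=
    fun f g => MemLp.coeFn_toLp _
  have hint : ∀ f : Lp A 1 μ, Integrable f μ := fun f => memLp_one_iff_integrable.1 (Lp.memLp f)
  have add_left : ∀ f f' g, B₀ (f + f') g = B₀ f g + B₀ f' g := fun f f' g => by
    refine Lp.ext ?_
    filter_upwards [B₀_coe (f + f') g, B₀_coe f g, B₀_coe f' g, Lp.coeFn_add (B₀ f g) (B₀ f' g),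
      ae_convolutionExistsAt (hint f) (hint g), ae_convolutionExistsAt (hint f') (hint g)]
      with x h1 h2 h3 h4 h5 h6
    rw [h1, h4, Pi.add_apply, h2, h3, convolution_congr_ae (Lp.coeFn_add f f') (ae_eq_refl _),
      h5.add_distrib h6]
  have smul_left : ∀ (c : ℂ) f g, B₀ (c • f) g = c • B₀ f g := fun c f g => by
    refine Lp.ext ?_
    filter_upwards [B₀_coe (c • f) g, B₀_coe f g, Lp.coeFn_smul c (B₀ f g)] with x h1 h2 h3
    rw [h1, h3, Pi.smul_apply, h2, convolution_congr_ae (Lp.coeFn_smul c f) (ae_eq_refl _),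
      smul_convolution, Pi.smul_apply]
  have comm : ∀ f g, B₀ f g = B₀ g f := fun f g => by
    refine Lp.ext ((B₀_coe f g).trans (EventuallyEq.trans ?_ (B₀_coe g f).symm))
    rw [conv_comm]
  have bound : ∀ f g, ‖B₀ f g‖ ≤ 1 * ‖f‖ * ‖g‖ := fun f g => by
    rw [Lp.norm_def, Lp.norm_def, Lp.norm_def, one_mul, ← ENNReal.toReal_mul,
      eLpNorm_congr_ae (B₀_coe f g)]
    exact ENNReal.toReal_mono (ENNReal.mul_ne_top (Lp.eLpNorm_ne_top f) (Lp.eLpNorm_ne_top g))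
      (eLpNorm_conv_le le_rfl (Lp.memLp f) (Lp.memLp g)).2
  let B : Lp A 1 μ →L[ℂ] Lp A 1 μ →L[ℂ] Lp A 1 μ := LinearMap.mkContinuous₂
    (LinearMap.mk₂ ℂ B₀ add_left smul_left
      (fun f g g' => by rw [comm f, add_left, comm g, comm g'])
      (fun c f g => by rw [comm f, smul_left, comm g])) 1 bound
  have B_coe : ∀ f g, (B f g : G → A) =ᵐ[μ] f ⋆[ContinuousLinearMap.mul ℂ A, μ] g := B₀_coe
  have cmem : ∀ F : C(G, A), MemLp F 1 μ := fun F =>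
    F.continuous.memLp_of_hasCompactSupport (HasCompactSupport.of_compactSpace _)
  have dense : DenseRange fun F : C(G, A) => (cmem F).toLp F := by
    intro f
    refine Metric.mem_closure_iff.2 fun ε hε => ?_
    obtain ⟨F, -, h2, h3, h4⟩ := (Lp.memLp f).exists_hasCompactSupport_eLpNorm_sub_le
      ENNReal.one_ne_top (ε := ENNReal.ofReal (ε / 2)) (by simpa using hε)
    refine ⟨_, ⟨⟨F, h3⟩, rfl⟩, ?_⟩
    rw [Lp.dist_def]
    refine lt_of_le_of_lt (ENNReal.toReal_mono ENNReal.ofReal_ne_top (le_trans (le_of_eq ?_) h2)) ?_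
    · exact eLpNorm_congr_ae ((ae_eq_refl _).sub (MemLp.coeFn_toLp _))
    · rw [ENNReal.toReal_ofReal (by positivity)]; linarith
  have B_c : ∀ (u v : Lp A 1 μ) (F H : G → A), u =ᵐ[μ] F → v =ᵐ[μ] H →
      B u v =ᵐ[μ] F ⋆[ContinuousLinearMap.mul ℂ A, μ] H := fun u v F H hu hv => by
    rw [← convolution_congr_ae hu hv]; exact B_coe u v
  have assoc : ∀ u v w, B (B u v) w = B u (B v w) := by
    intro u v w
    refine dense.induction_on₃ (p := fun u v w => B (B u v) w = B u (B v w)) ?_ ?_ u v w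
    · exact isClosed_eq (by fun_prop) (by fun_prop)
    · intro F H K
      refine Lp.ext ?_
      have eF := (cmem F).coeFn_toLp
      have eH := (cmem H).coeFn_toLp
      have eK := (cmem K).coeFn_toLp
      refine (B_c _ _ _ _ (B_c _ _ _ _ eF eH) eK).trans (EventuallyEq.trans ?_
        (B_c _ _ _ _ eF (B_c _ _ _ _ eH eK)).symm)
      rw [conv_assoc_continuous]
  have ef := (memLp_one_iff_integrable.2 hf).coeFn_toLp
  have eg := (memLp_one_iff_integrable.2 hg).coeFn_toLp
  have eh := (memLp_one_iff_integrable.2 hh).coeFn_toLp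
  refine (B_c _ _ _ _ (B_c _ _ _ _ ef eg) eh).symm.trans (EventuallyEq.trans ?_
    (B_c _ _ _ _ ef (B_c _ _ _ _ eg eh)))
  rw [assoc]

end Convolution

/-! ### The Banach algebra `L^p(G, A)` -/

section LpAlgebra

/-- The space `L^p(G, A)` of classes of `p`-integrable `A`-valued functions, with its usual
norm; it is a type synonym of Mathlib's `Lp A p μ` that carries the convolution product. -/
def ConvLp {G : Type*} [MeasurableSpace G] (A : Type*) [NormedAddCommGroup A] (p : ℝ≥0∞)
    (μ : Measure G) : Type _ :=
  Lp A p μ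

/-- The underlying element of `Lp A p μ`. -/
def ConvLp.toLp {G : Type*} [MeasurableSpace G] {A : Type*} [NormedAddCommGroup A] {p : ℝ≥0∞}
    {μ : Measure G} (f : ConvLp A p μ) : Lp A p μ :=
  f

/-- An element of `Lp A p μ`, regarded as an element of the convolution algebra. -/
def ConvLp.ofLp {G : Type*} [MeasurableSpace G] {A : Type*} [NormedAddCommGroup A] {p : ℝ≥0∞}
    {μ : Measure G} (f : Lp A p μ) : ConvLp A p μ :=
  f

variable {G : Type*} [AddCommGroup G] [TopologicalSpace G] [IsTopologicalAddGroup G]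
  [CompactSpace G] [MeasurableSpace G] [BorelSpace G]
  {A : Type*} [NonUnitalNormedCommRing A] [NormedSpace ℂ A] [IsScalarTower ℂ A A]
  [SMulCommClass ℂ A A] [CompleteSpace A]
  {p : ℝ≥0∞} [Fact (1 ≤ p)]
  {μ : Measure G} [μ.IsAddHaarMeasure] [IsProbabilityMeasure μ] [μ.Regular]

noncomputable instance ConvLp.instNormedAddCommGroup : NormedAddCommGroup (ConvLp A p μ) :=
  inferInstanceAs (NormedAddCommGroup (Lp A p μ))

/-- The convolution product of `L^p(G, A)`. -/
noncomputable instance ConvLp.instMul : Mul (ConvLp A p μ) where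
  mul f g := ConvLp.ofLp ((memLp_conv Fact.out (Lp.memLp f.toLp) (Lp.memLp g.toLp)).toLp
    (f.toLp ⋆[ContinuousLinearMap.mul ℂ A, μ] g.toLp))

theorem ConvLp.coeFn_mul (f g : ConvLp A p μ) :
    (f * g).toLp =ᵐ[μ] f.toLp ⋆[ContinuousLinearMap.mul ℂ A, μ] g.toLp :=
  MemLp.coeFn_toLp (memLp_conv Fact.out (Lp.memLp f.toLp) (Lp.memLp g.toLp))

theorem ConvLp.coeFn_add (f g : ConvLp A p μ) : (f + g).toLp =ᵐ[μ] ⇑f.toLp + ⇑g.toLp :=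
  Lp.coeFn_add f.toLp g.toLp

theorem ConvLp.norm_def (f : ConvLp A p μ) : ‖f‖ = (eLpNorm f.toLp p μ).toReal :=
  Lp.norm_def f.toLp

theorem ConvLp.ext_ae {f g : ConvLp A p μ} (h : f.toLp =ᵐ[μ] g.toLp) : f = g :=
  Lp.ext h

theorem ConvLp.integrable (f : ConvLp A p μ) : Integrable f.toLp μ :=
  (Lp.memLp f.toLp).integrable Fact.out

theorem ConvLp.mul_comm' (f g : ConvLp A p μ) : f * g = g * f := by
  refine ConvLp.ext_ae ((ConvLp.coeFn_mul f g).trans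
    (EventuallyEq.trans ?_ (ConvLp.coeFn_mul g f).symm))
  rw [conv_comm]

theorem ConvLp.add_mul' (f f' g : ConvLp A p μ) : (f + f') * g = f * g + f' * g := by
  refine ConvLp.ext_ae ?_
  filter_upwards [ConvLp.coeFn_mul (f + f') g, ConvLp.coeFn_mul f g, ConvLp.coeFn_mul f' g,
    ConvLp.coeFn_add (f * g) (f' * g), ae_convolutionExistsAt f.integrable g.integrable,
    ae_convolutionExistsAt f'.integrable g.integrable] with x h1 h2 h3 h4 h5 h6
  rw [h1, h4, Pi.add_apply, h2, h3, ← h5.add_distrib h6,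
    convolution_congr_ae (ConvLp.coeFn_add f f') (ae_eq_refl _)]

theorem ConvLp.mul_assoc' (f g h : ConvLp A p μ) : f * g * h = f * (g * h) := by
  refine ConvLp.ext_ae ((ConvLp.coeFn_mul (f * g) h).trans
    (EventuallyEq.trans ?_ (ConvLp.coeFn_mul f (g * h)).symm))
  rw [convolution_congr_ae (ConvLp.coeFn_mul f g) (ae_eq_refl _),
    convolution_congr_ae (ae_eq_refl _) (ConvLp.coeFn_mul g h)]
  exact conv_assoc_ae f.integrable g.integrable h.integrable

theorem ConvLp.zero_mul' (f : ConvLp A p μ) : 0 * f = 0 := by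
  have := ConvLp.add_mul' 0 0 f
  rwa [add_zero, left_eq_add] at this

/-- `L^p(G, A)` is a commutative normed algebra under convolution. -/
noncomputable instance ConvLp.instNonUnitalNormedCommRing :
    NonUnitalNormedCommRing (ConvLp A p μ) where
  __ := ConvLp.instNormedAddCommGroup
  __ := ConvLp.instMul
  left_distrib f g h := by
    change f * (g + h) = f * g + f * h
    rw [ConvLp.mul_comm', ConvLp.add_mul', ConvLp.mul_comm' g, ConvLp.mul_comm' h]
  right_distrib := ConvLp.add_mul'
  zero_mul := ConvLp.zero_mul'
  mul_zero f := by
    change f * 0 = 0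
    rw [ConvLp.mul_comm', ConvLp.zero_mul']
  mul_assoc := ConvLp.mul_assoc'
  mul_comm := ConvLp.mul_comm'
  norm_mul_le f g := by
    change ‖f * g‖ ≤ ‖f‖ * ‖g‖
    rw [ConvLp.norm_def, ConvLp.norm_def, ConvLp.norm_def, ← ENNReal.toReal_mul,
      eLpNorm_congr_ae (ConvLp.coeFn_mul f g)]
    exact ENNReal.toReal_mono (ENNReal.mul_ne_top (Lp.eLpNorm_ne_top _) (Lp.eLpNorm_ne_top _))
      (eLpNorm_conv_le Fact.out (Lp.memLp f.toLp) (Lp.memLp g.toLp)).2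

noncomputable instance ConvLp.instNormedSpace : NormedSpace ℂ (ConvLp A p μ) :=
  inferInstanceAs (NormedSpace ℂ (Lp A p μ))

instance ConvLp.instCompleteSpace : CompleteSpace (ConvLp A p μ) :=
  inferInstanceAs (CompleteSpace (Lp A p μ))

theorem ConvLp.coeFn_smul (c : ℂ) (f : ConvLp A p μ) : (c • f).toLp =ᵐ[μ] c • ⇑f.toLp :=
  Lp.coeFn_smul c f.toLp

theorem ConvLp.smul_mul' (c : ℂ) (f g : ConvLp A p μ) : c • f * g = c • (f * g) := by
  refine ConvLp.ext_ae ?_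
  filter_upwards [ConvLp.coeFn_mul (c • f) g, ConvLp.coeFn_mul f g,
    ConvLp.coeFn_smul c (f * g)] with x h1 h2 h3
  rw [h3, Pi.smul_apply, h2, ← Pi.smul_apply, ← smul_convolution,
    ← convolution_congr_ae (ConvLp.coeFn_smul c f) (ae_eq_refl _)]
  exact h1

instance ConvLp.instIsScalarTower : IsScalarTower ℂ (ConvLp A p μ) (ConvLp A p μ) where
  smul_assoc := ConvLp.smul_mul'

instance ConvLp.instSMulCommClass : SMulCommClass ℂ (ConvLp A p μ) (ConvLp A p μ) where
  smul_comm c f g := by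
    rw [smul_eq_mul, smul_eq_mul, mul_comm f, mul_comm f, ConvLp.smul_mul']

end LpAlgebra

/-! ### The Bochner-Schoenberg-Eberlein property of a commutative Banach algebra -/

section BSEProperty

variable (A : Type*) [NonUnitalNormedCommRing A] [NormedSpace ℂ A]

/-- A commutative Banach algebra is semisimple if its Gelfand transform is injective. -/
def IsSemisimple : Prop :=
  ∀ a : A, (∀ φ : characterSpace ℂ A, φ a = 0) → a = 0

variable {A} in
/-- A multiplier of `A` is a bounded linear operator `T` with `T (a b) = a T b`. -/
def IsMultiplier (T : A →L[ℂ] A) : Prop :=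
  ∀ a b : A, T (a * b) = a * T b

/-- The transforms of the multipliers of `A`: the bounded continuous functions `σ` on the character
space such that, for some multiplier `T`, the Gelfand transform of `T a` is `σ` times that of `a`,
for every `a`.  (Characters being nonzero, `T` determines `σ`.) -/
def multiplierTransforms : Set (characterSpace ℂ A →ᵇ ℂ) :=
  {σ | ∃ T : A →L[ℂ] A, IsMultiplier T ∧
    ∀ (a : A) (φ : characterSpace ℂ A), φ (T a) = σ φ * φ a}

/-- The BSE-functions: bounded continuous functions `σ` on the character space with
`|∑ α_k σ(φ_k)| ≤ β ‖∑ α_k φ_k‖` for some constant `β > 0`, the norm being that of the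
dual of `A`. -/
def bseFunctions : Set (characterSpace ℂ A →ᵇ ℂ) :=
  {σ | ∃ β : ℝ, 0 < β ∧ ∀ (n : ℕ) (α : Fin n → ℂ) (φ : Fin n → characterSpace ℂ A),
    ‖∑ k, α k * σ (φ k)‖ ≤ β * ‖∑ k, α k • CharacterSpace.toCLM (φ k)‖}

/-- `A` is a BSE-algebra if the transforms of its multipliers are exactly its BSE-functions. -/
def IsBSEAlgebra : Prop :=
  multiplierTransforms A = bseFunctions A

end BSEProperty

end BSE

namespace BSE

set_option linter.unusedSectionVars false
set_option linter.overlappingInstances false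

/-! ### Finite direct sums and the BSE property -/

section Corner

/-! For a continuous character `γ` of `G`, convolution gives `f * (γ a) = γ (f̂(γ) a)`. So `γ A` is
a copy of `A`, and an ideal of `L^p(G, A)` complemented by the kernel of the Fourier coefficient `f
↦ f̂(γ)` (`IsGroupChar.isCorner`). Along such a corner, functions on the character spaces restrict
and extend by zero, and both operations preserve BSE-functions and multiplier transforms. Hence the
BSE property passes from `L^p(G, A)` to `A` (take `γ = 1`), and from `A` to any finite sum of such
corners (`isBSEAlgebra_of_isCorner`). If `G` is finite, Fourier inversion (`sum_charEmb_pairing`)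
says that `L^p(G, A)` is such a sum.

That `G` must be finite is seen by testing the constant function `1`, the transform of the identity.
Fix a character `ψ` of `A`. For `H = ∑ α_k γ_k`, the BSE inequality at the characters `f ↦ ψ
(f̂(γ_k))` bounds `|∑ α_k| = |H(0)|` by the norm of a functional which, by Hölder, is at most a
constant times the `L^q` norm of `x ↦ H(-x)`, with `q` conjugate to `p`. Trigonometric polynomials
are uniformly dense, so evaluation at `0` is `L^q`-bounded on all of `C(G)`. Since `q < ∞`, this
fails when points are null: a function peaked at `0` has small `L^q` norm.

Density rests on Stone-Weierstrass and on group characters separating points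
(`exists_isGroupChar_ne_one`), which comes from Gelfand theory: the convolution powers of `u * u~`,
where `u~(x)` is the conjugate of `u(-x)`, have log-convex `L²` norms, so some multiplicative
functional `L` is nonzero at `u`, and `y ↦ L (translate y w) / L w` is a group character. -/

/-- The BSE inequality for sums over arbitrary finite sets. -/
theorem bse_bound_finset {A : Type*} [NonUnitalNormedCommRing A] [NormedSpace ℂ A]
    {σ : characterSpace ℂ A →ᵇ ℂ} {β : ℝ}
    (h : ∀ (n : ℕ) (α : Fin n → ℂ) (φ : Fin n → characterSpace ℂ A),
      ‖∑ k, α k * σ (φ k)‖ ≤ β * ‖∑ k, α k • CharacterSpace.toCLM (φ k)‖)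
    {ι : Type*} (s : Finset ι) (α : ι → ℂ) (φ : ι → characterSpace ℂ A) :
    ‖∑ k ∈ s, α k * σ (φ k)‖ ≤ β * ‖∑ k ∈ s, α k • CharacterSpace.toCLM (φ k)‖ := by
  have key := h _ (fun j => α (s.equivFin.symm j)) (fun j => φ (s.equivFin.symm j))
  rw [Equiv.sum_comp s.equivFin.symm (fun k : s => α k * σ (φ k)),
    Equiv.sum_comp s.equivFin.symm (fun k : s => α k • CharacterSpace.toCLM (φ k)),
    Finset.sum_coe_sort s (fun k => α k * σ (φ k)),
    Finset.sum_coe_sort s (fun k => α k • CharacterSpace.toCLM (φ k))] at key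
  exact key

variable {A : Type*} [NormedCommRing A] [NormedAlgebra ℂ A]
  {B : Type*} [NonUnitalNormedCommRing B] [NormedSpace ℂ B]

/-- `J` embeds the unital algebra `A` as a closed ideal of `B` that is complemented by the kernel of
the retraction `P`. -/
structure IsCorner (P : B →L[ℂ] A) (J : A →L[ℂ] B) : Prop where
  left_inv : ∀ a, P (J a) = a
  -- This one identity makes `P` and `J` multiplicative and `J 1` an idempotent with `b * J 1 = J (P
  -- b)`.
  mul_emb : ∀ b a, b * J a = J (P b * a)

namespace IsCorner

variable {P : B →L[ℂ] A} {J : A →L[ℂ] B}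

theorem emb_mul (h : IsCorner P J) (a b : A) : J (a * b) = J a * J b := by
  rw [h.mul_emb, h.left_inv]

theorem proj_mul (h : IsCorner P J) (b c : B) : P (b * c) = P b * P c := by
  have : J (P (b * c)) = J (P b * P c) := by
    rw [← mul_one (P (b * c)), ← h.mul_emb, mul_assoc, h.mul_emb c, h.mul_emb b, mul_one]
  rw [← h.left_inv (P (b * c)), this, h.left_inv]

/-- A character of `A` composed with the retraction. -/
noncomputable def push (h : IsCorner P J) (ψ : characterSpace ℂ A) : characterSpace ℂ B :=
  ⟨StrongDual.toWeakDual ((CharacterSpace.toCLM ψ).comp P), by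
    refine ⟨fun h0 => ?_, fun x y => ?_⟩
    · have := DFunLike.congr_fun h0 (J 1)
      change ψ (P (J 1)) = 0 at this
      rw [h.left_inv, map_one] at this
      exact one_ne_zero this
    · change ψ (P (x * y)) = ψ (P x) * ψ (P y)
      rw [h.proj_mul, map_mul]⟩

@[simp] theorem push_apply (h : IsCorner P J) (ψ : characterSpace ℂ A) (b : B) :
    h.push ψ b = ψ (P b) := rfl

theorem continuous_push (h : IsCorner P J) : Continuous h.push :=
  Continuous.subtype_mk (WeakDual.continuous_of_continuous_eval fun b =>
    (WeakDual.eval_continuous (P b)).comp continuous_subtype_val) _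

/-- A character of `B` that does not vanish on the ideal, restricted to the ideal. -/
noncomputable def pull (h : IsCorner P J) (φ : characterSpace ℂ B) (hφ : φ (J 1) ≠ 0) :
    characterSpace ℂ A :=
  ⟨StrongDual.toWeakDual ((CharacterSpace.toCLM φ).comp J), by
    refine ⟨fun h0 => hφ (DFunLike.congr_fun h0 1), fun x y => ?_⟩
    change φ (J (x * y)) = φ (J x) * φ (J y)
    rw [h.emb_mul, map_mul]⟩

@[simp] theorem pull_apply (h : IsCorner P J) (φ : characterSpace ℂ B) (hφ : φ (J 1) ≠ 0) (a : A) :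
    h.pull φ hφ a = φ (J a) := rfl

/-- `J 1` is idempotent, so a character takes only the values `0` and `1` there. -/
theorem apply_emb_one (h : IsCorner P J) (φ : characterSpace ℂ B) (hφ : φ (J 1) ≠ 0) :
    φ (J 1) = 1 := by
  have : φ (J 1) * φ (J 1) = φ (J 1) := by rw [← map_mul, ← h.emb_mul, mul_one]
  exact mul_right_cancel₀ hφ (by rw [this, one_mul])

theorem apply_emb_eq_zero (h : IsCorner P J) (φ : characterSpace ℂ B) (hφ : φ (J 1) = 0) (a : A) :
    φ (J a) = 0 := by
  rw [← mul_one a, h.emb_mul, map_mul, hφ, mul_zero]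

theorem apply_emb_proj (h : IsCorner P J) (φ : characterSpace ℂ B) (hφ : φ (J 1) ≠ 0) (b : B) :
    φ (J (P b)) = φ b := by
  rw [← mul_one (P b), ← h.mul_emb, map_mul, h.apply_emb_one φ hφ, mul_one]

/-- Together with `pull_push`, this identifies the characters of `A` with those characters of `B`
that do not vanish at `J 1`. -/
theorem push_pull (h : IsCorner P J) (φ : characterSpace ℂ B) (hφ : φ (J 1) ≠ 0) :
    h.push (h.pull φ hφ) = φ :=
  CharacterSpace.ext fun b => h.apply_emb_proj φ hφ b

theorem push_apply_emb_one_ne_zero (h : IsCorner P J) (ψ : characterSpace ℂ A) :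
    h.push ψ (J 1) ≠ 0 := by
  rw [push_apply, h.left_inv, map_one]; exact one_ne_zero

theorem pull_push (h : IsCorner P J) (ψ : characterSpace ℂ A) :
    h.pull (h.push ψ) (h.push_apply_emb_one_ne_zero ψ) = ψ :=
  CharacterSpace.ext fun a => by rw [pull_apply, push_apply, h.left_inv]

/-- Evaluation at `J 1` is continuous with values in `{0, 1}`. This is what makes extension by zero
continuous. -/
theorem isClopen_support (h : IsCorner P J) :
    IsClopen {φ : characterSpace ℂ B | φ (J 1) ≠ 0} := by
  have hc : Continuous fun φ : characterSpace ℂ B => φ (J 1) :=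
    (WeakDual.eval_continuous (J 1)).comp continuous_subtype_val
  refine ⟨?_, isOpen_ne.preimage hc⟩
  have : {φ : characterSpace ℂ B | φ (J 1) ≠ 0} = {φ | φ (J 1) = 1} := by
    ext φ
    exact ⟨h.apply_emb_one φ, fun h1 => by
      rw [Set.mem_ofPred_eq] at h1 ⊢; rw [h1]; exact one_ne_zero⟩
  rw [this]
  exact isClosed_singleton.preimage hc

open Classical in
/-- Extension by zero of a function on the characters of `A` to the characters of `B`. -/
noncomputable def extend (h : IsCorner P J) (σ : characterSpace ℂ A →ᵇ ℂ) :
    characterSpace ℂ B →ᵇ ℂ :=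
  BoundedContinuousFunction.ofNormedAddCommGroup
    (fun φ => if hφ : φ (J 1) ≠ 0 then σ (h.pull φ hφ) else 0)
    (by
      have ho := h.isClopen_support
      rw [← continuousOn_univ, ← Set.union_compl_self {φ : characterSpace ℂ B | φ (J 1) ≠ 0}]
      refine ContinuousOn.union_of_isOpen ?_ ?_ ho.isOpen ho.compl.isOpen
      · rw [continuousOn_iff_continuous_domRestrict]
        have : Continuous fun φ : {φ : characterSpace ℂ B | φ (J 1) ≠ 0} =>
            σ (h.pull φ.1 φ.2) :=
          σ.continuous.comp (Continuous.subtype_mk (WeakDual.continuous_of_continuous_eval fun a =>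
            (WeakDual.eval_continuous (J a)).comp
              (continuous_subtype_val.comp continuous_subtype_val)) _)
        refine this.congr fun φ => ?_
        change _ = if hφ : φ.1 (J 1) ≠ 0 then σ (h.pull φ.1 hφ) else 0
        split_ifs with hφ
        · rfl
        · exact absurd φ.2 hφ
      · exact continuousOn_const.congr fun φ hφ => dif_neg hφ)
    ‖σ‖ (fun φ => by
      split_ifs
      · exact σ.norm_coe_le_norm _
      · simp)

theorem extend_of_ne_zero (h : IsCorner P J) (σ : characterSpace ℂ A →ᵇ ℂ)
    (φ : characterSpace ℂ B) (hφ : φ (J 1) ≠ 0) : h.extend σ φ = σ (h.pull φ hφ) :=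
  dif_pos hφ

theorem extend_of_eq_zero (h : IsCorner P J) (σ : characterSpace ℂ A →ᵇ ℂ)
    (φ : characterSpace ℂ B) (hφ : φ (J 1) = 0) : h.extend σ φ = 0 :=
  dif_neg (not_not.2 hφ)

theorem extend_push (h : IsCorner P J) (σ : characterSpace ℂ A →ᵇ ℂ) (ψ : characterSpace ℂ A) :
    h.extend σ (h.push ψ) = σ ψ := by
  rw [h.extend_of_ne_zero σ _ (h.push_apply_emb_one_ne_zero ψ), h.pull_push]

/-- Restriction of a function on the characters of `B` to those of `A`. -/
noncomputable def restrict (h : IsCorner P J) (τ : characterSpace ℂ B →ᵇ ℂ) :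
    characterSpace ℂ A →ᵇ ℂ :=
  τ.compContinuous ⟨h.push, h.continuous_push⟩

theorem restrict_apply (h : IsCorner P J) (τ : characterSpace ℂ B →ᵇ ℂ) (ψ : characterSpace ℂ A) :
    h.restrict τ ψ = τ (h.push ψ) := rfl

theorem restrict_extend (h : IsCorner P J) (σ : characterSpace ℂ A →ᵇ ℂ) :
    h.restrict (h.extend σ) = σ := by
  ext ψ; rw [restrict_apply, extend_push]

/-- Pushing characters forward composes a combination of them with `P`, which costs a factor `‖P‖`;
the `+ 1` keeps the constant positive. -/
theorem restrict_mem_bseFunctions (h : IsCorner P J) {τ : characterSpace ℂ B →ᵇ ℂ}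
    (hτ : τ ∈ bseFunctions B) : h.restrict τ ∈ bseFunctions A := by
  obtain ⟨β, hβ, hb⟩ := hτ
  refine ⟨β * (‖P‖ + 1), by positivity, fun n α ψ => (hb n α fun k => h.push (ψ k)).trans ?_⟩
  have : ∑ k, α k • CharacterSpace.toCLM (h.push (ψ k))
      = (∑ k, α k • CharacterSpace.toCLM (ψ k)).comp P := by
    ext b; simp
  rw [this, mul_assoc]
  gcongr
  rw [mul_comm]
  refine (ContinuousLinearMap.opNorm_comp_le _ _).trans ?_
  gcongr
  linarith

/-- Characters vanishing at `J 1` contribute nothing to either side once the combination is composed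
with `J`; the others are pulled back to `A`. -/
theorem extend_mem_bseFunctions (h : IsCorner P J) {σ : characterSpace ℂ A →ᵇ ℂ}
    (hσ : σ ∈ bseFunctions A) : h.extend σ ∈ bseFunctions B := by
  classical
  obtain ⟨β, hβ, hb⟩ := hσ
  refine ⟨β * (‖J‖ + 1), by positivity, fun n α φ => ?_⟩
  have key := bse_bound_finset hb Finset.univ (fun k : {k : Fin n // φ k (J 1) ≠ 0} => α k)
    (fun k => h.pull (φ k) k.2)
  have e1 : ∑ k, α k * h.extend σ (φ k)
      = ∑ k : {k : Fin n // φ k (J 1) ≠ 0}, α k * σ (h.pull (φ k) k.2) := by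
    rw [← Fintype.sum_subtype_add_sum_subtype (fun k => φ k (J 1) ≠ 0), add_eq_left.2]
    · exact Finset.sum_congr rfl fun k _ => by rw [h.extend_of_ne_zero σ (φ k) k.2]
    · exact Finset.sum_eq_zero fun k _ => by
        rw [h.extend_of_eq_zero σ (φ k) (not_not.1 k.2), mul_zero]
  have e2 : ∑ k : {k : Fin n // φ k (J 1) ≠ 0}, α k • CharacterSpace.toCLM (h.pull (φ k) k.2)
      = (∑ k, α k • CharacterSpace.toCLM (φ k)).comp J := by
    ext a
    rw [← Fintype.sum_subtype_add_sum_subtype (fun k => φ k (J 1) ≠ 0)]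
    simp only [ContinuousLinearMap.comp_apply, add_apply,
      sum_apply, smul_apply, CharacterSpace.coe_toCLM,
      pull_apply]
    rw [left_eq_add]
    exact Finset.sum_eq_zero fun k _ => by
      rw [h.apply_emb_eq_zero (φ k) (not_not.1 k.2), smul_zero]
  rw [e1]
  refine key.trans ?_
  rw [e2, mul_assoc]
  gcongr
  rw [mul_comm]
  refine (ContinuousLinearMap.opNorm_comp_le _ _).trans ?_
  gcongr
  linarith

theorem extend_mem_multiplierTransforms (h : IsCorner P J) {σ : characterSpace ℂ A →ᵇ ℂ}
    (hσ : σ ∈ multiplierTransforms A) : h.extend σ ∈ multiplierTransforms B := by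
  obtain ⟨T, hT, hs⟩ := hσ
  refine ⟨J.comp (T.comp P), fun b c => ?_, fun b φ => ?_⟩
  · simp only [ContinuousLinearMap.comp_apply]
    rw [h.proj_mul, hT, h.mul_emb]
  · simp only [ContinuousLinearMap.comp_apply]
    by_cases hφ : φ (J 1) = 0
    · rw [h.apply_emb_eq_zero φ hφ, h.extend_of_eq_zero σ φ hφ, zero_mul]
    · rw [h.extend_of_ne_zero σ φ hφ, ← h.pull_apply φ hφ, hs, h.pull_apply,
        h.apply_emb_proj φ hφ]

theorem restrict_mem_multiplierTransforms (h : IsCorner P J) {τ : characterSpace ℂ B →ᵇ ℂ}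
    (hτ : τ ∈ multiplierTransforms B) : h.restrict τ ∈ multiplierTransforms A := by
  obtain ⟨S, hS, hs⟩ := hτ
  refine ⟨P.comp (S.comp J), fun a b => ?_, fun a ψ => ?_⟩
  · simp only [ContinuousLinearMap.comp_apply]
    rw [h.emb_mul, hS, h.proj_mul, h.left_inv]
  · simp only [ContinuousLinearMap.comp_apply]
    rw [← h.push_apply, hs, restrict_apply, h.push_apply, h.left_inv]

/-- The BSE property passes to a complemented unital ideal. -/
theorem isBSEAlgebra (h : IsCorner P J) (hB : IsBSEAlgebra B) : IsBSEAlgebra A := by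
  -- Both inclusions: extend `σ` to `B`, use the equality there, and restrict back.
  refine Set.Subset.antisymm (fun σ hσ => ?_) (fun σ hσ => ?_)
  · rw [← h.restrict_extend σ]
    refine h.restrict_mem_bseFunctions ?_
    rw [← hB]
    exact h.extend_mem_multiplierTransforms hσ
  · rw [← h.restrict_extend σ]
    refine h.restrict_mem_multiplierTransforms ?_
    rw [hB]
    exact h.extend_mem_bseFunctions hσ

end IsCorner

theorem add_mem_bseFunctions {A : Type*} [NonUnitalNormedCommRing A] [NormedSpace ℂ A]
    {σ τ : characterSpace ℂ A →ᵇ ℂ}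
    (hσ : σ ∈ bseFunctions A) (hτ : τ ∈ bseFunctions A) : σ + τ ∈ bseFunctions A := by
  obtain ⟨β, hβ, hb⟩ := hσ
  obtain ⟨γ, hγ, hc⟩ := hτ
  refine ⟨β + γ, by positivity, fun n α φ => ?_⟩
  simp only [BoundedContinuousFunction.coe_add, Pi.add_apply, mul_add, Finset.sum_add_distrib]
  rw [add_mul]
  exact (norm_add_le _ _).trans (add_le_add (hb n α φ) (hc n α φ))

theorem zero_mem_bseFunctions (A : Type*) [NonUnitalNormedCommRing A] [NormedSpace ℂ A] :
    0 ∈ bseFunctions A :=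
  ⟨1, one_pos, fun n α φ => by simp⟩

theorem add_mem_multiplierTransforms {A : Type*} [NonUnitalNormedCommRing A] [NormedSpace ℂ A]
    {σ τ : characterSpace ℂ A →ᵇ ℂ} (hσ : σ ∈ multiplierTransforms A)
    (hτ : τ ∈ multiplierTransforms A) : σ + τ ∈ multiplierTransforms A := by
  obtain ⟨S, hS, hs⟩ := hσ
  obtain ⟨T, hT, ht⟩ := hτ
  refine ⟨S + T, fun a b => ?_, fun a φ => ?_⟩
  · simp only [add_apply]; rw [hS, hT, mul_add]
  · simp only [add_apply, BoundedContinuousFunction.coe_add, Pi.add_apply]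
    rw [map_add, hs, ht, add_mul]

theorem zero_mem_multiplierTransforms (A : Type*) [NonUnitalNormedCommRing A] [NormedSpace ℂ A] :
    0 ∈ multiplierTransforms A :=
  ⟨0, fun a b => by simp, fun a φ => by simp⟩

/-- A finite direct sum of copies of a unital BSE-algebra is a BSE-algebra. -/
theorem isBSEAlgebra_of_isCorner {ι : Type*} [Fintype ι] {P : ι → B →L[ℂ] A} {J : ι → A →L[ℂ] B}
    (h : ∀ i, IsCorner (P i) (J i)) (hsum : ∀ b, ∑ i, J i (P i b) = b) (hA : IsBSEAlgebra A) :
    IsBSEAlgebra B := by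
  -- The supports of the `J i 1` partition the character space of `B`, so `τ` is the sum of its
  -- pieces.
  have dec : ∀ τ : characterSpace ℂ B →ᵇ ℂ, ∑ i, (h i).extend ((h i).restrict τ) = τ := by
    intro τ
    ext φ
    rw [BoundedContinuousFunction.coe_sum, Finset.sum_apply]
    have hterm : ∀ i, (h i).extend ((h i).restrict τ) φ = φ (J i 1) * τ φ := by
      intro i
      by_cases hφ : φ (J i 1) = 0
      · rw [(h i).extend_of_eq_zero _ φ hφ, hφ, zero_mul]
      · rw [(h i).extend_of_ne_zero _ φ hφ, (h i).restrict_apply, (h i).push_pull,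
          (h i).apply_emb_one φ hφ, one_mul]
    -- The element `∑ i, J i 1` is an identity of `B`, since `b * J i 1 = J i (P i b)`; multiplying
    -- by some `φ b ≠ 0` reads this off.
    have hone : ∑ i, φ (J i 1) = 1 := by
      obtain ⟨b, hb⟩ : ∃ b, φ b ≠ 0 := by
        by_contra! h0
        exact φ.2.1 (ContinuousLinearMap.ext h0)
      refine mul_left_cancel₀ hb ?_
      rw [mul_one, Finset.mul_sum]
      conv_rhs => rw [← hsum b, map_sum]
      refine Finset.sum_congr rfl fun i _ => ?_
      rw [← map_mul, (h i).mul_emb, mul_one]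
    simp_rw [hterm]
    rw [← Finset.sum_mul, hone, one_mul]
  refine Set.Subset.antisymm (fun τ hτ => ?_) (fun τ hτ => ?_)
  · rw [← dec τ]
    refine Finset.sum_induction _ (· ∈ bseFunctions B) (fun _ _ => add_mem_bseFunctions)
      (zero_mem_bseFunctions B) fun i _ => (h i).extend_mem_bseFunctions ?_
    rw [← hA]
    exact (h i).restrict_mem_multiplierTransforms hτ
  · rw [← dec τ]
    refine Finset.sum_induction _ (· ∈ multiplierTransforms B)
      (fun _ _ => add_mem_multiplierTransforms)
      (zero_mem_multiplierTransforms B) fun i _ => (h i).extend_mem_multiplierTransforms ?_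
    rw [hA]
    exact (h i).restrict_mem_bseFunctions hτ

end Corner

/-! ### Continuous group characters and the corresponding ideals of `L^p(G, A)` -/

section GroupCharacters

/-- A continuous function on `G` that is multiplicative and nonzero. -/
structure IsGroupChar {G : Type*} [AddCommGroup G] [TopologicalSpace G] (γ : C(G, ℂ)) : Prop where
  map_zero : γ 0 = 1
  map_add : ∀ x y, γ (x + y) = γ x * γ y

namespace IsGroupChar

variable {G : Type*} [AddCommGroup G] [TopologicalSpace G] {γ δ : C(G, ℂ)}

theorem one : IsGroupChar (1 : C(G, ℂ)) := ⟨rfl, fun _ _ => by simp⟩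

theorem mul (hγ : IsGroupChar γ) (hδ : IsGroupChar δ) : IsGroupChar (γ * δ) :=
  ⟨by simp [hγ.map_zero, hδ.map_zero], fun x y => by
    simp only [ContinuousMap.mul_apply, hγ.map_add, hδ.map_add]; ring⟩

theorem star (hγ : IsGroupChar γ) : IsGroupChar (star γ) :=
  ⟨by simp [hγ.map_zero], fun x y => by simp [hγ.map_add]⟩

/-- Replaces unimodularity: Fourier coefficients use `γ (-x)` instead of the conjugate of `γ x`, so
`|γ| = 1` is never needed. -/
theorem mul_neg (hγ : IsGroupChar γ) (x : G) : γ x * γ (-x) = 1 := by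
  rw [← hγ.map_add, add_neg_cancel, hγ.map_zero]

end IsGroupChar

variable {G : Type*} [AddCommGroup G] [TopologicalSpace G] [IsTopologicalAddGroup G]
  [CompactSpace G] [MeasurableSpace G] [BorelSpace G]
  {A : Type*} [NonUnitalNormedCommRing A] [NormedSpace ℂ A] [IsScalarTower ℂ A A]
  [SMulCommClass ℂ A A] [CompleteSpace A]
  {p : ℝ≥0∞} [Fact (1 ≤ p)]
  {μ : Measure G} [μ.IsAddHaarMeasure] [IsProbabilityMeasure μ] [μ.Regular]

theorem memLp_continuous (F : C(G, A)) (p : ℝ≥0∞) (μ : Measure G) [μ.IsAddHaarMeasure] :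
    MemLp F p μ :=
  F.continuous.memLp_of_hasCompactSupport (HasCompactSupport.of_compactSpace _)

variable (A p μ) in
/-- The inclusion of the continuous functions in `L^p(G, A)`. -/
noncomputable def contLp : C(G, A) →L[ℂ] ConvLp A p μ :=
  LinearMap.mkContinuous
    { toFun := fun F => ConvLp.ofLp ((memLp_continuous F p μ).toLp F)
      map_add' := fun F H => MemLp.toLp_add (memLp_continuous F p μ) (memLp_continuous H p μ)
      map_smul' := fun c F => MemLp.toLp_const_smul c (memLp_continuous F p μ) } 1
    (fun F => by
      change ‖(memLp_continuous F p μ).toLp F‖ ≤ _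
      rw [Lp.norm_toLp, one_mul]
      refine ENNReal.toReal_le_of_le_ofReal (norm_nonneg _) ?_
      refine (eLpNorm_le_of_ae_bound (Eventually.of_forall F.norm_coe_le_norm)).trans ?_
      simp)

theorem coeFn_contLp (F : C(G, A)) : (contLp A p μ F).toLp =ᵐ[μ] F :=
  MemLp.coeFn_toLp (memLp_continuous F p μ)

variable (A p μ) in
/-- Integration of the elements of `L^p(G, A)` against a continuous scalar function. -/
noncomputable def pairing (F : C(G, ℂ)) : ConvLp A p μ →L[ℂ] A :=
  LinearMap.mkContinuous
    { toFun := fun f => ∫ y, F y • f.toLp y ∂μ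
      map_add' := fun f g => by
        rw [← integral_add]
        · refine integral_congr_ae ?_
          filter_upwards [ConvLp.coeFn_add f g] with y hy
          rw [hy, Pi.add_apply, smul_add]
        · exact f.integrable.bdd_smul ‖F‖ F.continuous.aestronglyMeasurable
            (Eventually.of_forall F.norm_coe_le_norm)
        · exact g.integrable.bdd_smul ‖F‖ F.continuous.aestronglyMeasurable
            (Eventually.of_forall F.norm_coe_le_norm)
      map_smul' := fun c f => by
        rw [RingHom.id_apply, ← integral_smul]
        refine integral_congr_ae ?_
        filter_upwards [ConvLp.coeFn_smul c f] with y hy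
        rw [hy, Pi.smul_apply, smul_comm] } ‖F‖
    (fun f => by
      refine (norm_integral_le_integral_norm _).trans ?_
      have h1 : ∫ y, ‖f.toLp y‖ ∂μ ≤ ‖f‖ := by
        rw [ConvLp.norm_def, integral_norm_eq_lintegral_enorm f.integrable.1,
          ← eLpNorm_one_eq_lintegral_enorm]
        exact ENNReal.toReal_mono (Lp.eLpNorm_ne_top _)
          (eLpNorm_le_eLpNorm_of_exponent_le Fact.out f.integrable.1)
      calc ∫ y, ‖F y • f.toLp y‖ ∂μ ≤ ∫ y, ‖F‖ * ‖f.toLp y‖ ∂μ := by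
            refine integral_mono_of_nonneg (Eventually.of_forall fun y => norm_nonneg _)
              (f.integrable.norm.const_mul _) (Eventually.of_forall fun y => ?_)
            simp only [norm_smul]
            gcongr
            exact F.norm_coe_le_norm y
        _ = ‖F‖ * ∫ y, ‖f.toLp y‖ ∂μ := integral_const_mul _ _
        _ ≤ ‖F‖ * ‖f‖ := by gcongr)

theorem pairing_apply (F : C(G, ℂ)) (f : ConvLp A p μ) :
    pairing A p μ F f = ∫ y, F y • f.toLp y ∂μ := rfl

theorem integrable_smul (F : C(G, ℂ)) (f : ConvLp A p μ) :
    Integrable (fun y => F y • f.toLp y) μ :=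
  f.integrable.bdd_smul ‖F‖ F.continuous.aestronglyMeasurable
    (Eventually.of_forall F.norm_coe_le_norm)

theorem pairing_sum {ι : Type*} (s : Finset ι) (α : ι → ℂ) (F : ι → C(G, ℂ)) (f : ConvLp A p μ) :
    pairing A p μ (∑ k ∈ s, α k • F k) f = ∑ k ∈ s, α k • pairing A p μ (F k) f := by
  simp only [pairing_apply]
  simp_rw [← integral_smul]
  rw [← integral_finsetSum s fun k _ => by exact (integrable_smul (F k) f).smul (α k)]
  refine integral_congr_ae (Eventually.of_forall fun y => ?_)
  simp [Finset.sum_smul, mul_smul]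

/-- Hölder's inequality for the pairing. -/
theorem norm_pairing_le {q : ℝ≥0∞} [q.HolderConjugate p] (F : C(G, ℂ)) (f : ConvLp A p μ) :
    ‖pairing A p μ F f‖ ≤ (eLpNorm F q μ).toReal * ‖f‖ := by
  rw [pairing_apply, ConvLp.norm_def, ← ENNReal.toReal_mul]
  refine (norm_integral_le_integral_norm _).trans ?_
  rw [integral_norm_eq_lintegral_enorm (integrable_smul F f).1, ← eLpNorm_one_eq_lintegral_enorm]
  exact ENNReal.toReal_mono
    (ENNReal.mul_ne_top (memLp_continuous F q μ).eLpNorm_ne_top (Lp.eLpNorm_ne_top _))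
    (eLpNorm_smul_le_mul_eLpNorm (p := q) (q := p) (r := 1) (φ := F)
      (Lp.memLp f.toLp).1 F.continuous.aestronglyMeasurable)

end GroupCharacters

/-! ### The ideal attached to a group character; Fourier inversion on finite groups -/

section CharacterIdeal

variable {G : Type*} [AddCommGroup G] [TopologicalSpace G] [IsTopologicalAddGroup G]
  [CompactSpace G] [MeasurableSpace G] [BorelSpace G]
  {A : Type*} [NormedCommRing A] [NormedAlgebra ℂ A] [CompleteSpace A]
  {p : ℝ≥0∞} [Fact (1 ≤ p)]
  {μ : Measure G} [μ.IsAddHaarMeasure] [IsProbabilityMeasure μ] [μ.Regular]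

/-- The reflection `x ↦ F (-x)` of a continuous function. -/
noncomputable def reflect (F : C(G, ℂ)) : C(G, ℂ) := F.comp ⟨fun x => -x, continuous_neg⟩

@[simp] theorem reflect_apply (F : C(G, ℂ)) (x : G) : reflect F x = F (-x) := rfl

variable (A) in
/-- The continuous functions `x ↦ F x • a`. -/
noncomputable def tensorConst (F : C(G, ℂ)) : A →L[ℂ] C(G, A) :=
  LinearMap.mkContinuous
    { toFun := fun a => ⟨fun x => F x • a, by fun_prop⟩
      map_add' := fun a b => by ext x; simp
      map_smul' := fun c a => by ext x; exact smul_comm _ _ _ } ‖F‖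
    (fun a => (ContinuousMap.norm_le _ (by positivity)).2 fun x => by
      change ‖F x • a‖ ≤ _
      rw [norm_smul]
      gcongr
      exact F.norm_coe_le_norm x)

variable (A p μ) in
/-- The embedding `a ↦ γ a` of `A` in `L^p(G, A)`. -/
noncomputable def charEmb (γ : C(G, ℂ)) : A →L[ℂ] ConvLp A p μ :=
  (contLp A p μ).comp (tensorConst A γ)

theorem coeFn_charEmb (γ : C(G, ℂ)) (a : A) :
    (charEmb A p μ γ a).toLp =ᵐ[μ] fun x => γ x • a :=
  coeFn_contLp _

/-- Each group character yields a copy of `A` in `L^p(G, A)` as a complemented ideal; the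
retraction is the Fourier coefficient. -/
theorem IsGroupChar.isCorner {γ : C(G, ℂ)} (hγ : IsGroupChar γ) :
    IsCorner (pairing A p μ (reflect γ)) (charEmb A p μ γ) where
  left_inv a := by
    rw [pairing_apply]
    have : ∀ᵐ y ∂μ, reflect γ y • (charEmb A p μ γ a).toLp y = a := by
      filter_upwards [coeFn_charEmb (p := p) (μ := μ) γ a] with y hy
      rw [hy, smul_smul, reflect_apply, mul_comm, hγ.mul_neg, one_smul]
    rw [integral_congr_ae this]
    simp
  -- Convolution with `γ a` factors through the Fourier coefficient because `γ (x - y) = γ x * γ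
  -- (-y)`.
  mul_emb b a := by
    refine ConvLp.ext_ae ((ConvLp.coeFn_mul _ _).trans
      (EventuallyEq.trans (EventuallyEq.of_eq ?_) (coeFn_charEmb _ _).symm))
    rw [convolution_congr_ae (ae_eq_refl _) (coeFn_charEmb (p := p) (μ := μ) γ a)]
    ext x
    change ∫ y, b.toLp y * (γ (x - y) • a) ∂μ = _
    rw [pairing_apply]
    have e := ((ContinuousLinearMap.mul ℂ A).flip a).integral_comp_comm
      (integrable_smul (reflect γ) b)
    simp only [ContinuousLinearMap.flip_apply, ContinuousLinearMap.mul_apply'] at e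
    rw [← e, ← integral_smul]
    refine integral_congr_ae (Eventually.of_forall fun y => ?_)
    simp only [reflect_apply]
    rw [sub_eq_add_neg, hγ.map_add, mul_smul_comm, smul_mul_assoc, mul_smul]

/-- Fourier inversion on a finite group. -/
theorem sum_charEmb_pairing [T2Space G] [Finite G] (f : ConvLp A p μ) :
    ∑ γ : AddChar G ℂ, charEmb A p μ ⟨γ, continuous_of_discreteTopology⟩
      (pairing A p μ (reflect ⟨γ, continuous_of_discreteTopology⟩) f) = f := by
  classical
  have := Fintype.ofFinite G
  refine ConvLp.ext_ae ?_
  have hsum : ∀ (s : Finset (AddChar G ℂ)) (a : AddChar G ℂ → A),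
      (∑ γ ∈ s, charEmb A p μ ⟨γ, continuous_of_discreteTopology⟩ (a γ)).toLp =ᵐ[μ]
        fun x => ∑ γ ∈ s, γ x • a γ := by
    intro s a
    simp only [charEmb, ContinuousLinearMap.comp_apply]
    rw [← map_sum]
    refine (coeFn_contLp _).trans (EventuallyEq.of_eq ?_)
    ext x
    rw [ContinuousMap.coe_sum, Finset.sum_apply]
    rfl
  refine (hsum _ _).trans (EventuallyEq.of_eq ?_)
  ext x
  -- By translation invariance all points have the same mass, and the total is `1`.
  have hμ : ∀ y : G, μ.real {y} = (Fintype.card G : ℝ)⁻¹ := by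
    intro y
    have h0 : ∀ z : G, μ.real {z} = μ.real {y} := fun z => by
      have := measure_preimage_add μ (y - z) {y}
      have e : (fun h => y - z + h) ⁻¹' {y} = {z} := by
        ext w
        simp only [Set.mem_preimage, Set.mem_singleton_iff]
        constructor
        · intro h; rw [← sub_eq_zero] at h ⊢; rw [← h]; abel
        · rintro rfl; abel
      rw [e] at this
      simp [Measure.real, this]
    have h1 : ∑ z : G, μ.real {z} = 1 := by
      rw [sum_measureReal_singleton, Finset.coe_univ, probReal_univ]
    simp only [h0, Finset.sum_const, Finset.card_univ, nsmul_eq_mul] at h1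
    exact eq_inv_of_mul_eq_one_right h1
  simp only [pairing_apply]
  simp_rw [integral_fintype (integrable_smul _ f), hμ, Finset.smul_sum]
  rw [Finset.sum_comm]
  -- Orthogonality: `∑ γ, γ (x - y)` is the order of `G` when `x = y` and `0` otherwise.
  have hterm : ∀ y : G, ∑ γ : AddChar G ℂ, γ x • (Fintype.card G : ℝ)⁻¹ •
      reflect ⟨γ, continuous_of_discreteTopology⟩ y • f.toLp y
      = if x - y = 0 then f.toLp y else 0 := by
    intro y
    have : ∀ γ : AddChar G ℂ, γ x • (Fintype.card G : ℝ)⁻¹ •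
        reflect ⟨γ, continuous_of_discreteTopology⟩ y • f.toLp y
        = γ (x - y) • (Fintype.card G : ℝ)⁻¹ • f.toLp y := by
      intro γ
      rw [reflect_apply, ContinuousMap.coe_mk, sub_eq_add_neg, γ.map_add_eq_mul, mul_smul,
        smul_comm (γ (-y))]
    simp_rw [this]
    rw [← Finset.sum_smul, AddChar.sum_apply_eq_ite]
    split_ifs
    · rw [← Complex.coe_smul, smul_smul]
      have : (Fintype.card G : ℂ) ≠ 0 := by exact_mod_cast Fintype.card_ne_zero
      push_cast
      rw [mul_inv_cancel₀ this, one_smul]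
    · rw [zero_smul]
  simp_rw [hterm, sub_eq_zero]
  simp

/-- If `G` is finite and `A` is a BSE-algebra, then so is `L^p(G, A)`. -/
theorem isBSEAlgebra_convLp [T2Space G] [Finite G] (hA : IsBSEAlgebra A) :
    IsBSEAlgebra (ConvLp A p μ) :=
  isBSEAlgebra_of_isCorner (ι := AddChar G ℂ)
    (fun γ => IsGroupChar.isCorner (γ := ⟨γ, continuous_of_discreteTopology⟩)
      ⟨γ.map_zero_eq_one, γ.map_add_eq_mul⟩) sum_charEmb_pairing hA

end CharacterIdeal

/-! ### Continuous characters separate the points of a compact abelian group -/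

section Gelfand

variable {B : Type*} [NonUnitalNormedCommRing B] [NormedSpace ℂ B] [IsScalarTower ℂ B B]
  [SMulCommClass ℂ B B] [CompleteSpace B]

/-- If the powers of an element of a commutative Banach algebra do not decay faster than
geometrically, then some character does not vanish at that element. -/
theorem exists_character_apply_ne_zero {b : B} {w : ℕ → B} (hw0 : w 0 = b)
    (hw : ∀ n, w (n + 1) = b * w n) {c r : ℝ} (hc : 0 < c) (hr : 0 < r)
    (hcr : ∀ n, c * r ^ n ≤ ‖w n‖) :
    ∃ χ : B →L[ℂ] ℂ, (∀ x y, χ (x * y) = χ x * χ y) ∧ χ b ≠ 0 := by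
  -- Gelfand theory is applied in the `ℓ¹` unitization, into which `B` embeds isometrically.
  let _ : NormedCommRing (WithLp 1 (Unitization ℂ B)) :=
    { WithLp.instUnitizationNormedRing (𝕜 := ℂ) (A := B) with
      mul_comm := fun x y => congrArg (WithLp.toLp 1) (mul_comm (WithLp.ofLp x) (WithLp.ofLp y)) }
  let j : B → WithLp 1 (Unitization ℂ B) := fun a => WithLp.toLp 1 (a : Unitization ℂ B)
  have jmul : ∀ x y, j (x * y) = j x * j y := fun x y =>
    congrArg (WithLp.toLp 1) (Unitization.inr_mul ℂ x y)
  have jnorm : ∀ x, ‖j x‖ = ‖x‖ := fun x => WithLp.unitization_norm_inr x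
  have hpow : ∀ n, j b ^ (n + 1) = j (w n) := fun n => by
    induction n with
    | zero => rw [hw0, zero_add, pow_one]
    | succ n ih => rw [pow_succ', ih, ← jmul, hw]
  obtain ⟨φ, hφ⟩ : ∃ φ : characterSpace ℂ (WithLp 1 (Unitization ℂ B)), φ (j b) ≠ 0 := by
    -- If all characters vanished at `j b`, its spectral radius would be `0`, against the lower
    -- bound in Gelfand's formula.
    by_contra! h0
    have hsr : spectralRadius ℂ (j b) = 0 := by
      obtain ⟨z, hz, hz'⟩ := spectrum.exists_nnnorm_eq_spectralRadius (j b)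
      obtain ⟨φ, hφ⟩ := WeakDual.CharacterSpace.mem_spectrum_iff_exists.1 hz
      rw [← hz', ← hφ, h0 φ]
      simp
    have hlim := spectrum.pow_norm_pow_one_div_tendsto_nhds_spectralRadius (j b)
    rw [hsr] at hlim
    have h1 : ∀ᶠ n : ℕ in atTop, ENNReal.ofReal (‖j b ^ n‖ ^ (1 / (n : ℝ)))
        < ENNReal.ofReal (r / 2) :=
      hlim.eventually (gt_mem_nhds (by simpa using hr))
    -- The division by `r` absorbs the index shift: the power `n = m + 1` of `j b` is `j (w m)`,
    -- bounded below by `c * r ^ m`.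
    have h2 : ∀ᶠ n : ℕ in atTop, (1 / 2 : ℝ) ^ n < c / r :=
      (tendsto_pow_atTop_nhds_zero_of_lt_one (by norm_num) (by norm_num)).eventually
        (gt_mem_nhds (div_pos hc hr))
    obtain ⟨n, ⟨hn1, hn2⟩, hn0⟩ := ((h1.and h2).and (eventually_gt_atTop 0)).exists
    obtain ⟨m, rfl⟩ := Nat.exists_eq_succ_of_ne_zero hn0.ne'
    rw [ENNReal.ofReal_lt_ofReal_iff (by positivity)] at hn1
    have h3 : ‖j b ^ (m + 1)‖ < (r / 2) ^ (m + 1) := by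
      have := pow_lt_pow_left₀ hn1 (by positivity) hn0.ne'
      rwa [one_div, Real.rpow_inv_natCast_pow (norm_nonneg _) hn0.ne'] at this
    rw [hpow, jnorm] at h3
    have h4 := (hcr m).trans_lt h3
    rw [lt_div_iff₀ hr] at hn2
    have h5 : (r / 2) ^ (m + 1) = (1 / 2) ^ (m + 1) * r * r ^ m := by ring
    rw [h5] at h4
    exact lt_asymm hn2 (lt_of_mul_lt_mul_right h4 (by positivity))
  refine ⟨⟨{ toFun := fun x => φ (j x)
             map_add' := fun x y => ?_
             map_smul' := fun a x => ?_ }, ?_⟩, fun x y => ?_, hφ⟩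
  · rw [← map_add]
    exact congrArg φ (congrArg (WithLp.toLp 1) (Unitization.inr_add ℂ x y))
  · rw [RingHom.id_apply, ← map_smul]
    exact congrArg φ (congrArg (WithLp.toLp 1) (Unitization.inr_smul ℂ a x))
  · exact (map_continuous φ).comp WithLp.unitization_isometry_inr.continuous
  · change φ (j (x * y)) = φ (j x) * φ (j y)
    rw [jmul, map_mul]

end Gelfand

/-! ### Convolution of continuous scalar functions and separation of points -/

section Separation

variable {G : Type*} [AddCommGroup G] [TopologicalSpace G] [IsTopologicalAddGroup G]
  [CompactSpace G] [MeasurableSpace G] [BorelSpace G]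
  (μ : Measure G) [μ.IsAddHaarMeasure] [IsProbabilityMeasure μ] [μ.Regular]

/-- The convolution of continuous functions. -/
noncomputable def conv (u v : C(G, ℂ)) : C(G, ℂ) :=
  ⟨u ⋆[ContinuousLinearMap.mul ℂ ℂ, μ] v, continuous_conv u v⟩

theorem conv_apply (u v : C(G, ℂ)) (x : G) : conv μ u v x = ∫ y, u y * v (x - y) ∂μ := rfl

theorem conv_comm' (u v : C(G, ℂ)) : conv μ u v = conv μ v u :=
  DFunLike.coe_injective (conv_comm (μ := μ) u v)

theorem conv_assoc (u v w : C(G, ℂ)) : conv μ (conv μ u v) w = conv μ u (conv μ v w) :=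
  DFunLike.coe_injective (conv_assoc_continuous (μ := μ) u v w)

theorem contLp_conv {p : ℝ≥0∞} [Fact (1 ≤ p)] (u v : C(G, ℂ)) :
    contLp ℂ p μ (conv μ u v) = contLp ℂ p μ u * contLp ℂ p μ v := by
  refine ConvLp.ext_ae ((coeFn_contLp _).trans
    (EventuallyEq.trans ?_ (ConvLp.coeFn_mul _ _).symm))
  rw [convolution_congr_ae (coeFn_contLp u) (coeFn_contLp v)]
  rfl

/-- The involution `x ↦ conj (u (-x))`. -/
noncomputable def involution (u : C(G, ℂ)) : C(G, ℂ) := star (reflect u)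

theorem involution_apply (u : C(G, ℂ)) (x : G) : involution u x = star (u (-x)) := rfl

theorem involution_involution (u : C(G, ℂ)) : involution (involution u) = u := by
  ext x; simp [involution_apply]

theorem involution_conv (u v : C(G, ℂ)) :
    involution (conv μ u v) = conv μ (involution u) (involution v) := by
  ext x
  rw [involution_apply, conv_apply, conv_apply, ← integral_neg_eq_self]
  change (starRingEnd ℂ) _ = _
  rw [← integral_conj]
  refine integral_congr_ae (Eventually.of_forall fun y => ?_)
  simp only [involution_apply, map_mul]
  rw [show -(x - y) = -x - -y by abel]
  rfl

/-- This positivity makes `u * u~` nonzero for `u ≠ 0` and expresses `L²` norms as values of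
convolutions at `0`. -/
theorem conv_involution_zero (u : C(G, ℂ)) :
    conv μ u (involution u) 0 = (‖contLp ℂ 2 μ u‖ ^ 2 : ℝ) := by
  have h1 : ‖contLp ℂ 2 μ u‖ ^ 2 = ∫ y, ‖u y‖ ^ 2 ∂μ := by
    rw [ConvLp.norm_def, eLpNorm_congr_ae (coeFn_contLp u),
      (memLp_continuous u 2 μ).eLpNorm_eq_integral_rpow_norm (by simp) (by simp),
      ENNReal.toReal_ofReal (by positivity)]
    simp only [ENNReal.toReal_ofNat, Real.rpow_ofNat]
    rw [← Real.rpow_natCast, ← Real.rpow_mul (integral_nonneg fun y => by positivity)]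
    simp
  rw [h1, conv_apply, ← integral_complex_ofReal]
  refine integral_congr_ae (Eventually.of_forall fun y => ?_)
  simp only [involution_apply, zero_sub, neg_neg]
  rw [Complex.star_def, Complex.mul_conj, Complex.normSq_eq_norm_sq]

/-- Cauchy-Schwarz; for self-adjoint `v`, reflection does not change the absolute values beyond
`|v(-x)| = |v(x)|`, so the `L²` norm is kept. -/
theorem norm_conv_apply_zero_le (u v : C(G, ℂ)) (hv : involution v = v) :
    ‖conv μ u v 0‖ ≤ ‖contLp ℂ 2 μ u‖ * ‖contLp ℂ 2 μ v‖ := by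
  have h1 : conv μ u v 0 = pairing ℂ 2 μ (reflect v) (contLp ℂ 2 μ u) := by
    rw [conv_apply, pairing_apply]
    refine integral_congr_ae ?_
    filter_upwards [coeFn_contLp (p := 2) (μ := μ) u] with y hy
    rw [hy, zero_sub, reflect_apply, smul_eq_mul, mul_comm]
  have : (2 : ℝ≥0∞).HolderConjugate 2 := inferInstance
  rw [h1, mul_comm]
  refine (norm_pairing_le (q := 2) _ _).trans (le_of_eq ?_)
  congr 1
  rw [ConvLp.norm_def, eLpNorm_congr_ae (coeFn_contLp v)]
  congr 1
  refine eLpNorm_congr_norm_ae (Eventually.of_forall fun y => ?_)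
  conv_rhs => rw [← hv]
  rw [involution_apply, norm_star, reflect_apply]

theorem contLp_ne_zero {p : ℝ≥0∞} [Fact (1 ≤ p)] {u : C(G, ℂ)} (hu : u ≠ 0) :
    contLp ℂ p μ u ≠ 0 := by
  intro h
  refine hu (DFunLike.coe_injective ?_)
  refine (Continuous.ae_eq_iff_eq μ u.continuous (by fun_prop)).1 ?_
  refine (coeFn_contLp (p := p) u).symm.trans ?_
  rw [h]
  exact Lp.coeFn_zero _ _ _

/-- The iterated convolution powers `w, w * w, w * (w * w), …`. -/
noncomputable def convPow (w : C(G, ℂ)) : ℕ → C(G, ℂ)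
  | 0 => w
  | n + 1 => conv μ w (convPow w n)

/-- `convPow μ w n` is the convolution power of order `n + 1`, whence the `+ 1`. -/
theorem convPow_add (w : C(G, ℂ)) (n m : ℕ) :
    conv μ (convPow μ w n) (convPow μ w m) = convPow μ w (n + m + 1) := by
  induction n with
  | zero => rw [zero_add]; rfl
  | succ n ih =>
    rw [show convPow μ w (n + 1) = conv μ w (convPow μ w n) from rfl, conv_assoc, ih,
      show n + 1 + m + 1 = (n + m + 1) + 1 by ring]
    rfl

theorem involution_convPow {w : C(G, ℂ)} (hw : involution w = w) (n : ℕ) :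
    involution (convPow μ w n) = convPow μ w n := by
  induction n with
  | zero => exact hw
  | succ n ih =>
    rw [show convPow μ w (n + 1) = conv μ w (convPow μ w n) from rfl, involution_conv, hw, ih]

/-- The `L²` norms `a n` of the powers are log-convex, so the ratios `a (n + 1) / a n` never drop
below `a 1 / a 0`. -/
theorem exists_geometric_le_norm_convPow {w : C(G, ℂ)} (hw : involution w = w) (h0 : w ≠ 0) :
    ∃ c r : ℝ, 0 < c ∧ 0 < r ∧ ∀ n, c * r ^ n ≤ ‖contLp ℂ 2 μ (convPow μ w n)‖ := by
  set a : ℕ → ℝ := fun n => ‖contLp ℂ 2 μ (convPow μ w n)‖ with ha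
  have hsq : ∀ n, conv μ (convPow μ w n) (convPow μ w n) 0 = (a n ^ 2 : ℝ) := fun n => by
    have := conv_involution_zero μ (convPow μ w n)
    rwa [involution_convPow μ hw] at this
  -- The powers with indices `n` and `n + 2` have the same convolution as index `n + 1` with itself,
  -- whose value at `0` is `a (n + 1) ^ 2`; then Cauchy-Schwarz.
  have hlog : ∀ n, a (n + 1) ^ 2 ≤ a n * a (n + 2) := fun n => by
    have h1 := norm_conv_apply_zero_le μ (convPow μ w n) (convPow μ w (n + 2))
      (involution_convPow μ hw _)
    rw [convPow_add, show n + (n + 2) + 1 = (n + 1) + (n + 1) + 1 by ring, ← convPow_add, hsq,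
      Complex.norm_real, Real.norm_of_nonneg (by positivity)] at h1
    exact h1
  have a0 : 0 < a 0 := norm_pos_iff.2 (contLp_ne_zero μ h0)
  have a1 : 0 < a 1 := by
    refine norm_pos_iff.2 (contLp_ne_zero μ fun h => ?_)
    have h2 := hsq 0
    rw [convPow_add, zero_add, zero_add, h, ContinuousMap.zero_apply] at h2
    have h3 : a 0 ^ 2 = 0 := by exact_mod_cast h2.symm
    exact (pow_pos a0 2).ne' h3
  have step : ∀ n, 0 < a n ∧ a 1 / a 0 * a n ≤ a (n + 1) := fun n => by
    induction n with
    | zero => exact ⟨a0, by rw [div_mul_cancel₀ _ a0.ne']⟩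
    | succ n ih =>
      have hp : 0 < a (n + 1) := (mul_pos (div_pos a1 a0) ih.1).trans_le ih.2
      refine ⟨hp, le_of_mul_le_mul_left ?_ ih.1⟩
      calc a n * (a 1 / a 0 * a (n + 1)) = (a 1 / a 0 * a n) * a (n + 1) := by ring
        _ ≤ a (n + 1) * a (n + 1) := by gcongr; exact ih.2
        _ = a (n + 1) ^ 2 := by ring
        _ ≤ _ := hlog n
  refine ⟨a 0, a 1 / a 0, a0, div_pos a1 a0, fun n => ?_⟩
  induction n with
  | zero => simp [ha]
  | succ n ih =>
    calc a 0 * (a 1 / a 0) ^ (n + 1) = a 1 / a 0 * (a 0 * (a 1 / a 0) ^ n) := by ring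
      _ ≤ a 1 / a 0 * a n := by gcongr
      _ ≤ a (n + 1) := (step n).2

/-- The convolution algebra of continuous functions is semisimple. -/
theorem exists_convolution_character {u : C(G, ℂ)} (hu : u ≠ 0) :
    ∃ L : C(G, ℂ) →L[ℂ] ℂ, (∀ v w, L (conv μ v w) = L v * L w) ∧ L u ≠ 0 := by
  -- A character that is nonzero at this self-adjoint product is nonzero at its factor `u`.
  set w := conv μ u (involution u) with hw
  have hinv : involution w = w := by
    rw [hw, involution_conv, involution_involution, conv_comm']
  have hw0 : w ≠ 0 := fun h => by
    have h1 := conv_involution_zero μ u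
    rw [← hw, h, ContinuousMap.zero_apply] at h1
    have h3 : ‖contLp ℂ 2 μ u‖ ^ 2 = 0 := by exact_mod_cast h1.symm
    exact contLp_ne_zero μ hu (norm_eq_zero.1 (pow_eq_zero_iff two_ne_zero |>.1 h3))
  obtain ⟨c, r, hc, hr, h⟩ := exists_geometric_le_norm_convPow μ hinv hw0
  obtain ⟨χ, hχ, hχw⟩ := exists_character_apply_ne_zero (w := fun n => contLp ℂ 2 μ (convPow μ w n))
    rfl (fun n => contLp_conv μ w (convPow μ w n)) hc hr h
  refine ⟨χ.comp (contLp ℂ 2 μ), fun v v' => ?_, fun h0 => hχw ?_⟩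
  · simp only [ContinuousLinearMap.comp_apply]
    rw [contLp_conv, hχ]
  · change χ (contLp ℂ 2 μ w) = 0
    rw [hw, contLp_conv, hχ, show χ (contLp ℂ 2 μ u) = 0 from h0, zero_mul]

/-- The translate `x ↦ u (x - y)`. -/
noncomputable def translate (y : G) (u : C(G, ℂ)) : C(G, ℂ) :=
  u.comp ⟨fun x => x - y, by fun_prop⟩

theorem translate_apply (y : G) (u : C(G, ℂ)) (x : G) : translate y u x = u (x - y) := rfl

theorem continuous_translate (u : C(G, ℂ)) : Continuous fun y => translate y u := by
  have : Continuous (ContinuousMap.curry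
    (⟨fun q : G × G => u (q.2 - q.1), by fun_prop⟩ : C(G × G, ℂ))) :=
    ContinuousMap.continuous _
  exact this

/-- A translation may be moved from one factor to the other; this is why `L (translate y w) / L w`
is multiplicative in `y`. -/
theorem conv_translate (y : G) (u v : C(G, ℂ)) :
    conv μ (translate y u) v = conv μ u (translate y v) := by
  ext x
  simp only [conv_apply, translate_apply]
  rw [← integral_sub_right_eq_self (fun z => u z * v (x - z - y)) y]
  refine integral_congr_ae (Eventually.of_forall fun z => ?_)
  simp only [sub_sub, sub_add_cancel]

include μ in
/-- The continuous characters of a compact abelian group separate points from zero. -/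
theorem exists_isGroupChar_ne_one [T2Space G] {x : G} (hx : x ≠ 0) :
    ∃ γ : C(G, ℂ), IsGroupChar γ ∧ γ x ≠ 1 := by
  -- These values make `f` and `translate x f` differ at `0`.
  obtain ⟨f, hf0, hf1⟩ : ∃ f : C(G, ℂ), f 0 = 0 ∧ f (-x) = 1 := by
    obtain ⟨f, h0, h1, -⟩ := exists_continuous_zero_one_of_isClosed (X := G)
      (isClosed_singleton (x := 0)) (isClosed_singleton (x := -x))
      (by simpa using (neg_ne_zero.2 hx).symm)
    refine ⟨⟨fun z => (f z : ℂ), by fun_prop⟩, ?_, ?_⟩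
    · simp [h0 (Set.mem_singleton _)]
    · simp [h1 (Set.mem_singleton _)]
  have hu : f - translate x f ≠ 0 := fun h => by
    have := DFunLike.congr_fun h 0
    simp [translate_apply, hf0, hf1] at this
  obtain ⟨L, hL, hLu⟩ := exists_convolution_character μ hu
  obtain ⟨w, hw⟩ : ∃ w, L w ≠ 0 := ⟨_, hLu⟩
  have hLt : ∀ y u v, L (translate y u) * L v = L u * L (translate y v) := fun y u v => by
    rw [← hL, ← hL, conv_translate]
  refine ⟨⟨fun y => L (translate y w) / L w,
    (L.continuous.comp (continuous_translate w)).div_const _⟩, ⟨?_, fun y z => ?_⟩, fun h => ?_⟩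
  · have : translate 0 w = w := by ext; simp [translate_apply]
    simp [this, hw]
  · have : translate (y + z) w = translate y (translate z w) := by
      ext; simp [translate_apply, sub_sub]
    simp only [ContinuousMap.coe_mk]
    have h2 := hLt y (translate z w) w
    rw [← this] at h2
    field_simp
    linear_combination h2
  -- If the character were `1` at `x`, moving the translation would give `L (translate x f) = L f`,
  -- contradicting the choice of `L`.
  · simp only [ContinuousMap.coe_mk, div_eq_one_iff_eq hw] at h
    have h2 := hLt x f w
    rw [h] at h2
    refine hLu ?_
    rw [map_sub, mul_right_cancel₀ hw h2, sub_self]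

include μ in
/-- Trigonometric polynomials are dense in the continuous functions. -/
theorem exists_trigonometric_near [T2Space G] (F : C(G, ℂ)) {ε : ℝ} (hε : 0 < ε) :
    ∃ H ∈ Submodule.span ℂ {γ : C(G, ℂ) | IsGroupChar γ}, ‖H - F‖ < ε := by
  let S : StarSubalgebra ℂ C(G, ℂ) :=
    { toSubalgebra := Algebra.adjoin ℂ {γ : C(G, ℂ) | IsGroupChar γ}
      star_mem' := by
        change Algebra.adjoin ℂ {γ : C(G, ℂ) | IsGroupChar γ} ≤
          star (Algebra.adjoin ℂ {γ : C(G, ℂ) | IsGroupChar γ})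
        exact Algebra.adjoin_le fun γ hγ => Algebra.subset_adjoin hγ.star }
  have hsep : S.SeparatesPoints := by
    intro x y hxy
    obtain ⟨γ, hγ, h1⟩ := exists_isGroupChar_ne_one μ (sub_ne_zero.2 hxy)
    refine ⟨γ, ⟨γ, Algebra.subset_adjoin hγ, rfl⟩, fun h => h1 ?_⟩
    rw [sub_eq_add_neg, hγ.map_add, h, hγ.mul_neg]
  -- Group characters are closed under products, so the generated algebra is just their linear span.
  have hspan : Subalgebra.toSubmodule (Algebra.adjoin ℂ {γ : C(G, ℂ) | IsGroupChar γ})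
      = Submodule.span ℂ {γ : C(G, ℂ) | IsGroupChar γ} := by
    refine Algebra.adjoin_eq_span_of_subset _ (Set.Subset.trans ?_ Submodule.subset_span)
    intro γ hγ
    exact Submonoid.closure_induction (fun _ => id) IsGroupChar.one
      (fun _ _ _ _ => IsGroupChar.mul) hγ
  have htop := ContinuousMap.starSubalgebra_topologicalClosure_eq_top_of_separatesPoints S hsep
  have hF : F ∈ closure (S : Set C(G, ℂ)) := by
    rw [← StarSubalgebra.topologicalClosure_coe, htop]
    trivial
  obtain ⟨H, hH, hd⟩ := Metric.mem_closure_iff.1 hF ε hε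
  refine ⟨H, ?_, by rwa [dist_comm, dist_eq_norm] at hd⟩
  rw [← hspan]
  exact hH

end Separation

/-! ### The BSE property forces the group to be finite -/

section Finite

variable {G : Type*} [AddCommGroup G] [TopologicalSpace G] [IsTopologicalAddGroup G]
  [CompactSpace G] [MeasurableSpace G] [BorelSpace G]
  {A : Type*} [NormedCommRing A] [NormedAlgebra ℂ A] [CompleteSpace A]
  {p : ℝ≥0∞} [Fact (1 ≤ p)]
  {μ : Measure G} [μ.IsAddHaarMeasure] [IsProbabilityMeasure μ] [μ.Regular]

/-- The identity operator is a multiplier. That `1` is then a BSE-function is all that finiteness of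
`G` takes from the BSE property. -/
theorem one_mem_multiplierTransforms (B : Type*) [NonUnitalNormedCommRing B] [NormedSpace ℂ B] :
    1 ∈ multiplierTransforms B :=
  ⟨ContinuousLinearMap.id ℂ B, fun _ _ => rfl, fun a φ => by simp⟩

/-- If the constant `1` is a BSE-function of `L^p(G, A)`, then evaluation at `0` is bounded for the
norm of `L^q` on trigonometric polynomials. -/
theorem exists_norm_apply_zero_le_of_mem_span [Nontrivial A] {q : ℝ≥0∞} [q.HolderConjugate p]
    (h1 : 1 ∈ bseFunctions (ConvLp A p μ)) :
    ∃ C : ℝ, 0 < C ∧ ∀ H ∈ Submodule.span ℂ {γ : C(G, ℂ) | IsGroupChar γ},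
      ‖H 0‖ ≤ C * (eLpNorm (reflect H) q μ).toReal := by
  obtain ⟨β, hβ, hb⟩ := h1
  obtain ⟨ψ⟩ : Nonempty (characterSpace ℂ A) := inferInstance
  set K := ‖CharacterSpace.toCLM ψ‖
  refine ⟨β * (K + 1), by positivity, fun H hH => ?_⟩
  obtain ⟨n, α, γ, rfl⟩ := Submodule.mem_span_set'.1 hH
  have hγ : ∀ k, IsGroupChar (γ k).1 := fun k => (γ k).2
  have key := hb n α fun k => ((hγ k).isCorner (A := A) (p := p) (μ := μ)).push ψ
  -- Each `γ k` is `1` at `0`, so the left side of the BSE inequality is `|H(0)|`.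
  have e1 : (∑ k, α k • (γ k).1) 0 = ∑ k, α k * (1 : characterSpace ℂ (ConvLp A p μ) →ᵇ ℂ)
      (((hγ k).isCorner (A := A) (p := p) (μ := μ)).push ψ) := by
    rw [ContinuousMap.coe_sum, Finset.sum_apply]
    refine Finset.sum_congr rfl fun k _ => ?_
    simp [(hγ k).map_zero]
  rw [e1, mul_assoc]
  refine key.trans ?_
  gcongr
  refine ContinuousLinearMap.opNorm_le_bound _ (by positivity) fun f => ?_
  -- The combination of characters is `ψ` applied to the pairing with the reflected polynomial, so
  -- Hölder bounds its norm.
  have e2 : (∑ k, α k • CharacterSpace.toCLM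
      (((hγ k).isCorner (A := A) (p := p) (μ := μ)).push ψ)) f
      = CharacterSpace.toCLM ψ (pairing A p μ (reflect (∑ k, α k • (γ k).1)) f) := by
    have : reflect (∑ k, α k • (γ k).1) = ∑ k, α k • reflect (γ k).1 := by
      ext x; simp
    rw [this, pairing_sum, map_sum]
    simp
  rw [e2, mul_assoc]
  refine (ContinuousLinearMap.le_opNorm _ _).trans ?_
  gcongr
  · linarith
  · exact norm_pairing_le _ _

theorem eLpNorm_toReal_le_norm (F : C(G, ℂ)) (q : ℝ≥0∞) : (eLpNorm F q μ).toReal ≤ ‖F‖ := by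
  refine ENNReal.toReal_le_of_le_ofReal (norm_nonneg _) ?_
  refine (eLpNorm_le_of_ae_bound (Eventually.of_forall F.norm_coe_le_norm)).trans ?_
  simp

theorem norm_reflect_le (F : C(G, ℂ)) : ‖reflect F‖ ≤ ‖F‖ :=
  (ContinuousMap.norm_le _ (norm_nonneg _)).2 fun x => F.norm_coe_le_norm (-x)

/-- The sup norm controls both evaluation at `0` and the `L^q` norm, so the bound passes from
trigonometric polynomials to their uniform limits. -/
theorem exists_norm_apply_zero_le [T2Space G] [Nontrivial A] {q : ℝ≥0∞} (hq : 1 ≤ q)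
    [q.HolderConjugate p] (h1 : 1 ∈ bseFunctions (ConvLp A p μ)) :
    ∃ C : ℝ, 0 < C ∧ ∀ F : C(G, ℂ), ‖F 0‖ ≤ C * (eLpNorm F q μ).toReal := by
  obtain ⟨C, hC, hspan⟩ := exists_norm_apply_zero_le_of_mem_span (q := q) h1
  refine ⟨C, hC, fun F => le_of_forall_pos_le_add fun ε hε => ?_⟩
  -- `F` is reflected because the bound for `H` involves `reflect H`. The error enters once at `0`
  -- and `C` times in `L^q`, hence `ε / (1 + C)`.
  obtain ⟨H, hH, hHF⟩ := exists_trigonometric_near μ (reflect F)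
    (show 0 < ε / (1 + C) by positivity)
  have h2 : ‖F 0‖ ≤ ‖H 0‖ + ‖H - reflect F‖ := by
    have h3 := (H - reflect F).norm_coe_le_norm 0
    rw [ContinuousMap.sub_apply, reflect_apply, neg_zero] at h3
    have := norm_sub_norm_le (F 0) (H 0)
    rw [norm_sub_rev] at this
    linarith
  have h3 : (eLpNorm (reflect H) q μ).toReal ≤ (eLpNorm F q μ).toReal + ‖H - reflect F‖ := by
    have e : (reflect H : G → ℂ) = F + reflect (H - reflect F) := by
      ext x; simp
    have hfin := fun u : C(G, ℂ) => (memLp_continuous u q μ).eLpNorm_ne_top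
    rw [e]
    refine (ENNReal.toReal_mono (ENNReal.add_ne_top.2 ⟨hfin _, hfin _⟩)
      (eLpNorm_add_le F.continuous.aestronglyMeasurable
        (reflect (H - reflect F)).continuous.aestronglyMeasurable hq)).trans ?_
    rw [ENNReal.toReal_add (hfin _) (hfin _)]
    gcongr
    exact (eLpNorm_toReal_le_norm _ _).trans (norm_reflect_le _)
  rw [lt_div_iff₀ (by positivity)] at hHF
  have h4 := hspan H hH
  have h5 := mul_le_mul_of_nonneg_left h3 hC.le
  linarith

/-- All points have equal mass, and infinitely many of positive mass would exceed the finite total.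
-/
theorem measure_singleton_zero_of_infinite [T2Space G] [Infinite G] : μ {(0 : G)} = 0 := by
  by_contra h
  refine measure_ne_top μ Set.univ (Set.Infinite.meas_eq_top Set.infinite_univ ⟨μ {0}, h, ?_⟩)
  intro x _
  have := measure_preimage_add μ (-x) {0}
  have e : (fun h => -x + h) ⁻¹' {0} = {x} := by
    ext w
    simp only [Set.mem_preimage, Set.mem_singleton_iff, neg_add_eq_zero, eq_comm]
  rw [← this, e]

/-- On an infinite compact group, evaluation at `0` is not bounded for the norm of `L^q`. -/
theorem exists_lt_norm_apply_zero [T2Space G] [Infinite G] {q : ℝ≥0∞} (hq : q ≠ 0) (hq' : q ≠ ∞)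
    {C : ℝ} (hC : 0 < C) : ∃ F : C(G, ℂ), C * (eLpNorm F q μ).toReal < ‖F 0‖ := by
  have hqr : 0 < q.toReal := ENNReal.toReal_pos hq hq'
  -- A function with values in `[0, 1]`, equal to `1` at `0` and vanishing off an open set of
  -- measure below `δ ^ q`, has `L^q` norm at most `δ`, and `C * δ = 1 / 2 < 1`.
  set δ : ℝ≥0∞ := ENNReal.ofReal (1 / (2 * C))
  have hδ : 0 < δ ^ q.toReal :=
    ENNReal.rpow_pos (ENNReal.ofReal_pos.2 (by positivity)) ENNReal.ofReal_ne_top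
  obtain ⟨U, hU0, hUo, hU⟩ := Set.exists_isOpen_lt_of_lt ({0} : Set G) (δ ^ q.toReal)
    (by rw [measure_singleton_zero_of_infinite (μ := μ)]; exact hδ)
  obtain ⟨f, hf0, hf1, hf⟩ := exists_continuous_zero_one_of_isClosed (X := G)
    hUo.isClosed_compl (isClosed_singleton (x := 0))
    (Set.disjoint_compl_left_iff_subset.2 hU0)
  refine ⟨⟨fun x => (f x : ℂ), by fun_prop⟩, ?_⟩
  have hf0' : f 0 = 1 := hf1 rfl
  have hle : eLpNorm (fun x => (f x : ℂ)) q μ ≤ δ := by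
    refine (eLpNorm_mono (g := U.indicator fun _ => (1 : ℝ)) fun x => ?_).trans
      ((eLpNorm_indicator_const_le _ _).trans ?_)
    · by_cases hx : x ∈ U
      · simpa [hx, abs_of_nonneg (hf x).1] using (hf x).2
      · simp [hx, show f x = 0 from hf0 hx]
    · rw [enorm_one, one_mul, one_div, ← ENNReal.rpow_rpow_inv hqr.ne' δ]
      gcongr
  have hreal := ENNReal.toReal_le_of_le_ofReal (by positivity) hle
  simp only [ContinuousMap.coe_mk, hf0', Complex.ofReal_one, norm_one]
  calc C * _ ≤ C * (1 / (2 * C)) := by gcongr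
    _ < 1 := by field_simp; norm_num

/-- If `L^p(G, A)` is a BSE-algebra for some `p > 1`, then `G` is finite. -/
theorem finite_of_isBSEAlgebra_convLp [T2Space G] [Nontrivial A] (hp : 1 < p)
    (h : IsBSEAlgebra (ConvLp A p μ)) : Finite G := by
  by_contra hG
  rw [not_finite_iff_infinite] at hG
  have h1 : 1 ∈ bseFunctions (ConvLp A p μ) := h ▸ one_mem_multiplierTransforms _
  have : p.HolderConjugate p.conjExponent := .conjExponent hp.le
  have : p.conjExponent.HolderConjugate p := .symm
  have hq : 1 ≤ p.conjExponent := ENNReal.HolderConjugate.one_le p.conjExponent p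
  obtain ⟨C, hC, hle⟩ := exists_norm_apply_zero_le hq h1
  -- Here `1 < p` is essential: it makes the conjugate exponent finite. For exponent `∞`, evaluation
  -- at `0` is bounded on continuous functions.
  obtain ⟨F, hF⟩ := exists_lt_norm_apply_zero (μ := μ) (q := p.conjExponent)
    (zero_lt_one.trans_le hq).ne'
    ((ENNReal.HolderConjugate.ne_top_iff_ne_one p.conjExponent p).2 hp.ne') hC
  exact (hle F).not_gt hF

end Finite

end BSE


theorem theorem3p5 {A : Type*} [NormedCommRing A] [NormedAlgebra ℂ A] [CompleteSpace A]
    [TopologicalSpace.SeparableSpace A] [Nontrivial A] (hA : BSE.IsSemisimple A)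
    {G : Type*} [AddCommGroup G] [TopologicalSpace G] [IsTopologicalAddGroup G]
    [CompactSpace G] [T2Space G] [MeasurableSpace G] [BorelSpace G]
    (μ : Measure G) [μ.IsAddHaarMeasure] [μ.Regular] [IsProbabilityMeasure μ]
    (p : ℝ≥0∞) [Fact (1 ≤ p)] (hp : 1 < p) (hp' : p < ∞) :
    BSE.IsBSEAlgebra (BSE.ConvLp A p μ) ↔ BSE.IsBSEAlgebra A ∧ Finite G := by
  -- The trivial character embeds `A` as the ideal of constant functions.
  refine ⟨fun h => ⟨BSE.IsGroupChar.one.isCorner.isBSEAlgebra h,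
    BSE.finite_of_isBSEAlgebra_convLp hp h⟩, fun ⟨h, hG⟩ => ?_⟩
  exact BSE.isBSEAlgebra_convLp h
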